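/- Let $P$ be a probability measure on $\mathbb{R}$ with bounded support, and for $N \ge 1$ let $P_N = P^{\otimes N}$. Let $\bar x = (\bar x_i)_{1 \le i \le N}$ have law $P_N$, let $W = (W_{ij})_{1 \le i,j \le N}$ and $z = (z_i)_{1 \le i \le N}$ have independent standard Gaussian entries, and let $\bar x$, $W$, $z$ be independent; denote by $\mathbb{E}$ the expectation with respect to $(\bar x, W, z)$. For $t, h \ge 0$ and $x \in \mathbb{R}^N$ set $$H_N(t,h,x) := \sqrt{\tfrac{t}{N}}\, x \cdot W x + \tfrac{t}{N} (x \cdot \bar x)^2 - \tfrac{t}{2N} |x|^4 + \sqrt{h}\, z \cdot x + h\, x \cdot \bar x - \tfrac{h}{2} |x|^2 ,$$ $$F_N(t,h) := \frac{1}{N} \log \int_{\mathbb{R}^N} e^{H_N(t,h,x)} \, \mathrm{d}P_N(x), \qquad \bar F_N(t,h) := \mathbb{E}[F_N(t,h)] .$$ Then there exists a constant $C < \infty$, depending only on $P$, such that for every $N \ge 1$ and every $(t,h) \in [0,\infty)^2$, at the point $(t,h)$, $$0 \le \partial_t \bar F_N - 2 (\partial_h \bar F_N)^2 \le \frac{2}{N}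 \partial_h^2 \bar F_N + 2\, \mathbb{E}\left[ (\partial_h F_N - \partial_h \bar F_N)^2 \right] + \frac{C}{N} \left( \frac{1}{h} + \frac{1}{\sqrt{h}} \right),$$ and moreover $\partial_h \bar F_N \ge 0$. Here the derivatives at $t = 0$ and at $h = 0$ are one-sided, and the right side of the upper bound is interpreted as $+\infty$ when $h = 0$. The assertion includes that $F_N(t,h)$ is integrable, that $\partial_t \bar F_N$ and $\partial_h \bar F_N$ exist on $[0,\infty)^2$, and that for $h > 0$ the derivatives $\partial_h F_N$ and $\partial_h^2 \bar F_N$ exist and $(\partial_h F_N - \partial_h \bar F_N)^2$ is integrable. -/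

import Mathlib

open MeasureTheory ProbabilityTheory Set

noncomputable section

namespace RankOne

/-- A realization `ω = (x̄, W, z)` of the randomness of the model of size `N`:
the signal `x̄`, the noise matrix `W` and the noise vector `z`. -/
abbrev Disorder (N : ℕ) : Type :=
  (Fin N → ℝ) × (Fin N × Fin N → ℝ) × (Fin N → ℝ)

/-- The law `P_N = P^{⊗ N}` on `ℝ^N`. -/
def priorN (P : Measure ℝ) (N : ℕ) : Measure (Fin N → ℝ) :=
  Measure.pi fun _ => P

/-- The joint law of `(x̄, W, z)`: the coordinates of `x̄` have law `P`, those of `W` and of `z` are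
standard Gaussian, and all of these variables are independent. -/
def disorderLaw (P : Measure ℝ) (N : ℕ) : Measure (Disorder N) :=
  (priorN P N).prod
    ((Measure.pi fun _ : Fin N × Fin N => gaussianReal 0 1).prod
      (Measure.pi fun _ : Fin N => gaussianReal 0 1))

/-- The enriched Hamiltonian
`H_N(t,h,x) = √(t/N) x·Wx + (t/N) (x·x̄)² - (t/(2N)) |x|⁴ + √h z·x + h x·x̄ - (h/2) |x|²`. -/
def hamiltonian (N : ℕ) (t h : ℝ) (ω : Disorder N) (x : Fin N → ℝ) : ℝ :=
  √(t / N) * (∑ i, ∑ j, ω.2.1 (i, j) * x i * x j)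
    + t / N * (∑ i, x i * ω.1 i) ^ 2
    - t / (2 * N) * (∑ i, x i ^ 2) ^ 2
    + √h * (∑ i, ω.2.2 i * x i)
    + h * (∑ i, x i * ω.1 i)
    - h / 2 * (∑ i, x i ^ 2)

/-- The random free energy `F_N(t,h)`. -/
def freeEnergy (P : Measure ℝ) (N : ℕ) (ω : Disorder N) (t h : ℝ) : ℝ :=
  1 / N * Real.log (∫ x, Real.exp (hamiltonian N t h ω x) ∂(priorN P N))

/-- The averaged free energy `F̄_N(t,h) = 𝔼[F_N(t,h)]`. -/
def avgFreeEnergy (P : Measure ℝ) (N : ℕ) (t h : ℝ) : ℝ :=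
  ∫ ω, freeEnergy P N ω t h ∂(disorderLaw P N)

/-- The partial derivative `∂_t f` of a function on `[0,∞)²`, one-sided at `t = 0`. -/
def partialT (f : ℝ → ℝ → ℝ) (t h : ℝ) : ℝ :=
  derivWithin (fun s => f s h) (Ici 0) t

/-- The partial derivative `∂_h f` of a function on `[0,∞)²`, one-sided at `h = 0`. -/
def partialH (f : ℝ → ℝ → ℝ) (t h : ℝ) : ℝ :=
  derivWithin (fun s => f t s) (Ici 0) h

end RankOne

end

open RankOne

/-!
For fixed `t` and `h`, the exponential of the Hamiltonian is the likelihood ratio of a Gaussian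
channel: the signal `x̄` is observed through the features `x̄_i x̄_j / √N` with strength `t` and
through `x̄_i` with strength `h`. Both derivatives are therefore instances of one computation, for
features `φ_k` with strengths `s_k = σ_k + a_k θ` moving along a line. Write `m_k = ⟨φ_k⟩` and
`C_kl = ⟨φ_k φ_l⟩ - m_k m_l` for the moments under the Gibbs measure, which is the posterior law of
the signal.

Two tools carry the proof. Gaussian integration by parts (`BddFam.integral_coord_mul`) removes the
noise, with `∂m_k/∂g_l = √s_l C_kl`. The Nishimori identity (`nishimori`) says that in expectations
against functions of the observation, `f(x̄)` may be replaced by `⟨f⟩`. It follows from the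
Cameron-Martin formula and Fubini's theorem. Together they give, for the log-partition function,

* `∂_θ 𝔼[log Z] = ½ ∑ a_k 𝔼[m_k²]` (`hasDerivWithinAt_integral_logZ`), also at `θ = 0`, by
  continuity of the right side;
* `∂_θ 𝔼[m_k²] = ∑ a_l 𝔼[C_kl²]` (`hasDerivAt_integral_gm_sq`), for `θ > 0`.

Writing `R` for the overlap `x · x'` of two replicas, the first formula gives
`∂_t F̄_N = 𝔼⟨R²⟩ / (2N²)` and `∂_h F̄_N = 𝔼⟨R⟩ / (2N)`, so that
`∂_t F̄_N - 2 (∂_h F̄_N)²` is the variance of `R` divided by `2N²`. This is the lower bound, and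
also the monotonicity in `h`, since `𝔼⟨R⟩ = 𝔼|⟨x⟩|²`.

For the upper bound, let `U = ∂_θ log Z` and `V = ∑ a_k (φ_k(x̄) m_k - m_k² / 2)`. The difference
`U - V` is a compensated noise term, and it is orthogonal to `V` (`integral_dlogZ_mul_proxy`): after
integration by parts only `∑ a_k a_l 𝔼[m_k C_kl (φ_l(x̄) - m_l)] = 0` is left. Hence
`𝔼[U²] ≥ 𝔼[V²]`, and `𝔼[V²]` is explicit by the Nishimori identity. Together with the formula for
the second derivative and Jensen's inequality for the Gibbs measure, this bounds the variance of `R`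
(`variance_overlap_le`), and the constant `C` of the theorem can be taken to be zero.
-/

namespace RankOne

open Filter Topology

/-! ### Gaussian integration by parts and Gaussian shifts -/

section Gaussian

/-- Stein's identity: `𝔼[Z f(Z)] = 𝔼[f'(Z)]` for a standard Gaussian variable `Z`. -/
lemma integral_mul_gaussianReal_eq_integral_deriv {f f' : ℝ → ℝ} {K : ℝ}
    (hf : ∀ x, HasDerivAt f (f' x) x) (hfK : ∀ x, |f x| ≤ K)
    (hf'm : Measurable f') (hfK' : ∀ x, |f' x| ≤ K) :
    ∫ x, x * f x ∂(gaussianReal 0 1) = ∫ x, f' x ∂(gaussianReal 0 1) := by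
  have hfm : Measurable f := (continuous_iff_continuousAt.2 fun x => (hf x).continuousAt).measurable
  rw [integral_gaussianReal_eq_integral_smul one_ne_zero,
    integral_gaussianReal_eq_integral_smul one_ne_zero]
  set p : ℝ → ℝ := gaussianPDFReal 0 1 with hp
  have hpd : ∀ x, HasDerivAt (fun y => -p y) (x * p x) x := by
    intro x
    have h1 : HasDerivAt (fun y : ℝ => -(y - 0) ^ 2 / (2 * ((1 : NNReal) : ℝ))) (-x) x := by
      have := (((hasDerivAt_id x).sub_const 0).pow 2).neg.div_const (2 * ((1 : NNReal) : ℝ))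
      refine this.congr_deriv ?_
      simp
      ring
    have h2 := ((h1.exp).const_mul (√(2 * Real.pi * ((1 : NNReal) : ℝ)))⁻¹).neg
    refine h2.congr_deriv ?_
    simp only [hp, gaussianPDFReal]
    ring
  have hpi : Integrable p := integrable_gaussianPDFReal 0 1
  have hxp : Integrable (fun x => x * p x) := by
    have h : Integrable (fun x : ℝ => x) (gaussianReal 0 1) :=
      (memLp_id_gaussianReal 1).integrable le_rfl
    rw [gaussianReal_of_var_ne_zero _ one_ne_zero, gaussianPDF_def,
      integrable_withDensity_iff (measurable_gaussianPDFReal _ _).ennreal_ofReal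
        (by simp)] at h
    refine h.congr (Filter.Eventually.of_forall fun x => ?_)
    simp [ENNReal.toReal_ofReal (gaussianPDFReal_nonneg _ _ _), hp]
  have key := integral_mul_deriv_eq_deriv_mul_of_integrable (u := f) (u' := f')
    (v := fun y => -p y) (v' := fun x => x * p x)
    (fun x _ => hf x) (fun x _ => hpd x)
    (hxp.bdd_mul hfm.aestronglyMeasurable (c := K) (Filter.Eventually.of_forall hfK))
    (hpi.neg.bdd_mul hf'm.aestronglyMeasurable (c := K) (Filter.Eventually.of_forall hfK'))
    (hpi.neg.bdd_mul hfm.aestronglyMeasurable (c := K) (Filter.Eventually.of_forall hfK))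
  simp only [mul_neg, integral_neg, neg_neg] at key
  calc _ = ∫ x, f x * (x * p x) := by congr 1; ext x; simp; ring
    _ = ∫ x, f' x * p x := key
    _ = _ := by congr 1; ext x; simp; ring

variable {κ : Type*} [Fintype κ]

/-- The law of a standard Gaussian vector indexed by `κ`. -/
noncomputable def stdGaussianPi (κ : Type*) [Fintype κ] : Measure (κ → ℝ) :=
  Measure.pi fun _ => gaussianReal 0 1

instance : IsProbabilityMeasure (stdGaussianPi κ) := by
  unfold stdGaussianPi; infer_instance

lemma measurePreserving_eval_stdGaussianPi (k : κ) :
    MeasurePreserving (fun g : κ → ℝ => g k) (stdGaussianPi κ) (gaussianReal 0 1) :=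
  measurePreserving_eval (fun _ => gaussianReal 0 1) k

/-- Resampling one coordinate of a product of probability measures preserves the product. -/
lemma measurePreserving_update_pi [DecidableEq κ] {X : Type*} [MeasurableSpace X]
    (ν : κ → Measure X) [∀ k, IsProbabilityMeasure (ν k)] (k : κ) :
    MeasurePreserving (fun p : (κ → X) × X => Function.update p.1 k p.2)
      ((Measure.pi ν).prod (ν k)) (Measure.pi ν) := by
  have hm : Measurable (fun p : (κ → X) × X => Function.update p.1 k p.2) := by
    refine measurable_pi_iff.2 fun j => ?_
    by_cases h : j = k
    · subst h; simpa using measurable_snd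
    · simp only [Function.update_of_ne h]
      fun_prop
  refine ⟨hm, (Measure.pi_eq fun s hs => ?_).symm⟩
  rw [Measure.map_apply hm (MeasurableSet.univ_pi hs)]
  have : (fun p : (κ → X) × X => Function.update p.1 k p.2) ⁻¹' (univ.pi s)
      = (univ.pi (Function.update s k univ)) ×ˢ s k := by
    ext ⟨g, r⟩
    simp only [mem_preimage, Set.mem_pi, mem_univ, true_imp_iff, mem_prod]
    constructor
    · intro h
      refine ⟨fun j => ?_, by simpa using h k⟩
      by_cases hj : j = k
      · subst hj; simp
      · simpa [Function.update_of_ne hj] using h j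
    · rintro ⟨h, hr⟩ j
      by_cases hj : j = k
      · subst hj; simpa using hr
      · simpa [Function.update_of_ne hj] using h j
  rw [this, Measure.prod_prod, Measure.pi_pi,
    ← Finset.mul_prod_erase _ _ (Finset.mem_univ k),
    ← Finset.mul_prod_erase _ (fun i => ν i (s i)) (Finset.mem_univ k)]
  simp only [Function.update_self, measure_univ, one_mul]
  rw [mul_comm]
  congr 1
  refine Finset.prod_congr rfl fun j hj => ?_
  rw [Function.update_of_ne (Finset.ne_of_mem_erase hj)]

lemma integrable_coord_mul_stdGaussianPi {f : (κ → ℝ) → ℝ} {K : ℝ} (k : κ)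
    (hfm : Measurable f) (hfK : ∀ g, |f g| ≤ K) :
    Integrable (fun g => g k * f g) (stdGaussianPi κ) := by
  have h : Integrable (fun g : κ → ℝ => g k) (stdGaussianPi κ) :=
    (measurePreserving_eval_stdGaussianPi k).integrable_comp_of_integrable
      (g := fun x : ℝ => x) ((memLp_id_gaussianReal 1).integrable le_rfl)
  exact h.mul_bdd (c := K) hfm.aestronglyMeasurable (Filter.Eventually.of_forall hfK)

/-- Gaussian integration by parts in the coordinate `k`. -/
lemma integral_coord_mul_stdGaussianPi [DecidableEq κ] {f f' : (κ → ℝ) → ℝ} {K : ℝ} (k : κ)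
    (hf : ∀ g, HasDerivAt (fun r => f (Function.update g k r)) (f' g) (g k))
    (hfm : Measurable f) (hfK : ∀ g, |f g| ≤ K)
    (hf'm : Measurable f') (hfK' : ∀ g, |f' g| ≤ K) :
    ∫ g, g k * f g ∂(stdGaussianPi κ) = ∫ g, f' g ∂(stdGaussianPi κ) := by
  have mp : MeasurePreserving (fun p : (κ → ℝ) × ℝ => Function.update p.1 k p.2)
      ((stdGaussianPi κ).prod (gaussianReal 0 1)) (stdGaussianPi κ) :=
    measurePreserving_update_pi (fun _ : κ => gaussianReal 0 1) k
  have hu : ∀ g : κ → ℝ, Measurable fun r : ℝ => Function.update g k r :=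
    fun g => measurable_update g
  have h1 : Integrable (fun g => g k * f g) (stdGaussianPi κ) :=
    integrable_coord_mul_stdGaussianPi k hfm hfK
  have h2 : Integrable f' (stdGaussianPi κ) :=
    Integrable.of_bound hf'm.aestronglyMeasurable K (Filter.Eventually.of_forall hfK')
  have e : ∀ F : (κ → ℝ) → ℝ, Integrable F (stdGaussianPi κ) → ∫ g, F g ∂(stdGaussianPi κ)
      = ∫ g, ∫ r, F (Function.update g k r) ∂(gaussianReal 0 1) ∂(stdGaussianPi κ) := by
    intro F hF
    have hc := mp.integrable_comp_of_integrable hF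
    have := integral_prod _ hc
    rw [← mp.map_eq] at hF
    calc ∫ g, F g ∂(stdGaussianPi κ)
        = ∫ g, F g ∂(Measure.map _ _) := by rw [mp.map_eq]
      _ = _ := integral_map mp.measurable.aemeasurable hF.1
      _ = _ := this
  rw [e _ h1, e _ h2]
  congr 1
  ext g
  simp only [Function.update_self]
  refine integral_mul_gaussianReal_eq_integral_deriv (K := K) (fun r => ?_) (fun r => hfK _)
    (hf'm.comp (hu g)) (fun r => hfK' _)
  simpa using hf (Function.update g k r)

/-- The Cameron-Martin formula on the line. -/
lemma gaussianReal_eq_withDensity_exp (b : ℝ) :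
    gaussianReal b 1 = (gaussianReal 0 1).withDensity
      fun x => ENNReal.ofReal (Real.exp (b * x - b ^ 2 / 2)) := by
  rw [gaussianReal_of_var_ne_zero _ one_ne_zero, gaussianReal_of_var_ne_zero _ one_ne_zero,
    ← withDensity_mul _ (measurable_gaussianPDF _ _) (by fun_prop)]
  congr 1
  ext x
  simp only [gaussianPDF, Pi.mul_apply, gaussianPDFReal]
  rw [← ENNReal.ofReal_mul (by positivity), mul_assoc _ (Real.exp _) (Real.exp _), ← Real.exp_add]
  congr 3
  simp
  ring

lemma integrable_exp_shift (b : κ → ℝ) :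
    Integrable (fun g : κ → ℝ => ∏ k, Real.exp (b k * g k - b k ^ 2 / 2)) (stdGaussianPi κ) := by
  refine Integrable.fintype_prod (f := fun k x => Real.exp (b k * x - b k ^ 2 / 2)) fun k => ?_
  simp only [Real.exp_sub]
  exact (integrable_exp_mul_gaussianReal (b k)).div_const _

/-- The Cameron-Martin formula in finite dimension, as an identity of measures. -/
lemma map_add_stdGaussianPi (b : κ → ℝ) :
    (stdGaussianPi κ).map (fun g => g + b) = (stdGaussianPi κ).withDensity
      fun g => ENNReal.ofReal (∏ k, Real.exp (b k * g k - b k ^ 2 / 2)) := by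
  have h1 : (stdGaussianPi κ).map (fun g => g + b) = Measure.pi fun k => gaussianReal (b k) 1 := by
    have e := Measure.pi_map_pi (μ := fun _ : κ => gaussianReal 0 1)
      (f := fun k (x : ℝ) => x + b k) (fun k => by fun_prop)
    simp only [gaussianReal_map_add_const, zero_add] at e
    exact e
  rw [h1]
  refine Measure.pi_eq fun s hs => ?_
  have hm : Measurable (fun g : κ → ℝ => ∏ k, Real.exp (b k * g k - b k ^ 2 / 2)) := by fun_prop
  rw [withDensity_apply _ (MeasurableSet.univ_pi hs),
    ← ofReal_integral_eq_lintegral_ofReal (integrable_exp_shift b).integrableOn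
      (Filter.Eventually.of_forall fun g => by positivity),
    ← integral_indicator (MeasurableSet.univ_pi hs)]
  have h2 : ∀ k, gaussianReal (b k) 1 (s k) = ENNReal.ofReal
      (∫ x, (s k).indicator (fun x => Real.exp (b k * x - b k ^ 2 / 2)) x ∂(gaussianReal 0 1)) := by
    intro k
    rw [gaussianReal_eq_withDensity_exp, withDensity_apply _ (hs k),
      ← ofReal_integral_eq_lintegral_ofReal _ (Filter.Eventually.of_forall fun g => by positivity),
      ← integral_indicator (hs k)]
    simp only [Real.exp_sub]
    exact ((integrable_exp_mul_gaussianReal (b k)).div_const _).integrableOn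
  simp_rw [h2]
  rw [← ENNReal.ofReal_prod_of_nonneg
    (fun k _ => integral_nonneg fun x => indicator_nonneg (fun x _ => (Real.exp_pos _).le) _),
    ← integral_fintype_prod_eq_prod]
  congr 2
  ext g
  by_cases h : g ∈ univ.pi s
  · rw [indicator_of_mem h]
    refine Finset.prod_congr rfl fun k _ => ?_
    rw [indicator_of_mem (h k (mem_univ k))]
  · rw [indicator_of_notMem h]
    simp only [Set.mem_pi, mem_univ, true_imp_iff, not_forall] at h
    obtain ⟨k, hk⟩ := h
    rw [Finset.prod_eq_zero (Finset.mem_univ k)]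
    rw [indicator_of_notMem hk]

lemma integral_add_stdGaussianPi (b : κ → ℝ) {G : (κ → ℝ) → ℝ} (hG : Measurable G) :
    ∫ g, G (g + b) ∂(stdGaussianPi κ)
      = ∫ g, (∏ k, Real.exp (b k * g k - b k ^ 2 / 2)) * G g ∂(stdGaussianPi κ) := by
  have hm : Measurable (fun g : κ → ℝ => ∏ k, Real.exp (b k * g k - b k ^ 2 / 2)) := by fun_prop
  rw [← integral_map (φ := fun g => g + b) (by fun_prop) hG.aestronglyMeasurable,
    map_add_stdGaussianPi]
  rw [integral_withDensity_eq_integral_toReal_smul (by fun_prop) (by simp)]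
  congr 1
  ext g
  rw [ENNReal.toReal_ofReal (by positivity), smul_eq_mul]

end Gaussian

/-! ### Gibbs averages with bounded energies -/

section Gibbs

lemma abs_energy_le {E J : Type*} [Fintype J] {ψ : E → J → ℝ} {B R : ℝ} {c : J → ℝ}
    (hc : ‖c‖ ≤ R) {x : E}
    (hx : ∀ j, |ψ x j| ≤ B) : |∑ j, c j * ψ x j| ≤ Fintype.card J * (R * B) := by
  refine (Finset.abs_sum_le_sum_abs _ _).trans ?_
  refine (Finset.sum_le_sum (g := fun _ => R * B) fun j _ => ?_).trans (by simp)
  rw [abs_mul]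
  exact mul_le_mul ((norm_le_pi_norm c j).trans hc) (hx j) (abs_nonneg _)
    ((norm_nonneg _).trans hc)

variable {E J : Type*} [MeasurableSpace E] [Fintype J]

/-- A bounded observable: a measurable function that is essentially bounded for `μ`. -/
structure BddObs (μ : Measure E) (f : E → ℝ) : Prop where
  meas : Measurable f
  bdd : ∃ K, ∀ᵐ x ∂μ, |f x| ≤ K

lemma BddObs.mul {μ : Measure E} {f g : E → ℝ} (hf : BddObs μ f) (hg : BddObs μ g) :
    BddObs μ (fun x => f x * g x) := by
  obtain ⟨K, hK⟩ := hf.bdd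
  obtain ⟨L, hL⟩ := hg.bdd
  refine ⟨hf.meas.mul hg.meas, K * L, ?_⟩
  filter_upwards [hK, hL] with x h1 h2
  rw [abs_mul]
  exact mul_le_mul h1 h2 (abs_nonneg _) ((abs_nonneg _).trans h1)

lemma BddObs.const (μ : Measure E) (a : ℝ) : BddObs μ (fun _ => a) :=
  ⟨measurable_const, |a|, Filter.Eventually.of_forall fun _ => le_rfl⟩

lemma BddObs.integrable {μ : Measure E} [IsFiniteMeasure μ] {f : E → ℝ} (hf : BddObs μ f) :
    Integrable f μ := by
  obtain ⟨K, hK⟩ := hf.bdd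
  exact Integrable.of_bound hf.meas.aestronglyMeasurable K hK

lemma BddObs.mono_ac {μ ν : Measure E} {f : E → ℝ} (hf : BddObs μ f) (h : ν ≪ μ) :
    BddObs ν f := by
  obtain ⟨K, hK⟩ := hf.bdd
  exact ⟨hf.meas, K, h.ae_le hK⟩

lemma exists_uniform_bound {μ : Measure E} {ψ : E → J → ℝ}
    (hψ : ∀ j, BddObs μ (fun x => ψ x j)) : ∃ B, 0 ≤ B ∧ ∀ᵐ x ∂μ, ∀ j, |ψ x j| ≤ B := by
  choose K hK using fun j => (hψ j).bdd
  refine ⟨∑ j, |K j|, Finset.sum_nonneg fun _ _ => abs_nonneg _, ?_⟩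
  filter_upwards [ae_all_iff.2 hK] with x hx j
  exact ((hx j).trans (le_abs_self _)).trans
    (Finset.single_le_sum (f := fun j => |K j|) (fun _ _ => abs_nonneg _) (Finset.mem_univ j))

/-- The unnormalized Gibbs integral `∫ f exp(c · ψ) dμ`. -/
noncomputable def expIntegral (μ : Measure E) (ψ : E → J → ℝ) (f : E → ℝ) (c : J → ℝ) : ℝ :=
  ∫ x, f x * Real.exp (∑ j, c j * ψ x j) ∂μ

/-- The Gibbs measure with density proportional to `exp(c · ψ)` with respect to `μ`. -/
noncomputable def gibbsMeasure (μ : Measure E) (ψ : E → J → ℝ) (c : J → ℝ) : Measure E :=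
  μ.tilted fun x => ∑ j, c j * ψ x j

/-- The Gibbs average of `f`. -/
noncomputable def gibbsAvg (μ : Measure E) (ψ : E → J → ℝ) (f : E → ℝ) (c : J → ℝ) : ℝ :=
  ∫ x, f x ∂(gibbsMeasure μ ψ c)

variable {μ : Measure E} {ψ : E → J → ℝ} {f : E → ℝ}

lemma bddObs_exp_energy (hψ : ∀ j, BddObs μ (fun x => ψ x j)) (c : J → ℝ) :
    BddObs μ (fun x => Real.exp (∑ j, c j * ψ x j)) := by
  obtain ⟨B, hB, hb⟩ := exists_uniform_bound hψ
  refine ⟨?_, Real.exp (Fintype.card J * (‖c‖ * B)), ?_⟩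
  · have := fun j => (hψ j).meas
    fun_prop
  · filter_upwards [hb] with x hx
    rw [abs_of_pos (Real.exp_pos _), Real.exp_le_exp]
    exact (le_abs_self _).trans (abs_energy_le le_rfl hx)

lemma gibbsMeasure_ac (c : J → ℝ) : gibbsMeasure μ ψ c ≪ μ := tilted_absolutelyContinuous _ _

lemma integral_sum_smul {V : Type*} [NormedAddCommGroup V] [NormedSpace ℝ V] [CompleteSpace V]
    (L : J → V) {a : J → E → ℝ} (ha : ∀ j, Integrable (a j) μ) :
    Integrable (fun x => ∑ j, a j x • L j) μ ∧
      ∫ x, ∑ j, a j x • L j ∂μ = ∑ j, (∫ x, a j x ∂μ) • L j := by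
  refine ⟨integrable_finsetSum _ fun j _ => (ha j).smul_const (L j), ?_⟩
  rw [integral_finsetSum _ fun j _ => (ha j).smul_const (L j)]
  exact Finset.sum_congr rfl fun j _ => integral_smul_const _ _

/-- Differentiation of a Gibbs integral whose coefficients `L j c` depend linearly on a point `c` of
a normed space. -/
lemma hasFDerivAt_integral_mul_exp [IsFiniteMeasure μ] (hψ : ∀ j, BddObs μ (fun x => ψ x j))
    (hf : BddObs μ f) {H : Type*} [NormedAddCommGroup H] [NormedSpace ℝ H]
    (L : J → (H →L[ℝ] ℝ)) (c : H) :
    HasFDerivAt (fun c => ∫ x, f x * Real.exp (∑ j, L j c * ψ x j) ∂μ)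
      (∑ j, (∫ x, f x * ψ x j * Real.exp (∑ j, L j c * ψ x j) ∂μ) • L j) c := by
  obtain ⟨B, hB, hb⟩ := exists_uniform_bound hψ
  obtain ⟨K, hK⟩ := hf.bdd
  have hint : ∀ c : H, ∀ j, Integrable
      (fun x => f x * ψ x j * Real.exp (∑ j, L j c * ψ x j)) μ :=
    fun c j => ((hf.mul (hψ j)).mul (bddObs_exp_energy hψ fun j => L j c)).integrable
  obtain ⟨hF'i, hF'e⟩ := integral_sum_smul L (hint c)
  have hbound : ∀ᵐ x ∂μ, ∀ c' ∈ Metric.ball c 1,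
      ‖∑ j, (f x * ψ x j * Real.exp (∑ j, L j c' * ψ x j)) • L j‖ ≤
      ∑ j : J, K * B * Real.exp (∑ j, ‖L j‖ * (‖c‖ + 1) * B) * ‖L j‖ := by
    filter_upwards [hb, hK] with x hx hfx c' hc'
    have hn : ‖c'‖ ≤ ‖c‖ + 1 := by
      have h1 : ‖c' - c‖ < 1 := by simpa [dist_eq_norm] using hc'
      have h2 := norm_add_le (c' - c) c
      rw [sub_add_cancel] at h2
      linarith
    refine (norm_sum_le _ _).trans (Finset.sum_le_sum fun j _ => ?_)
    rw [norm_smul]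
    refine mul_le_mul_of_nonneg_right ?_ (norm_nonneg _)
    rw [Real.norm_eq_abs, abs_mul, abs_mul, abs_of_pos (Real.exp_pos _)]
    have hK0 : 0 ≤ K := (abs_nonneg _).trans hfx
    refine mul_le_mul (mul_le_mul hfx (hx j) (abs_nonneg _) hK0) ?_ (Real.exp_pos _).le
      (by positivity)
    refine Real.exp_le_exp.2 (Finset.sum_le_sum fun j _ => (le_abs_self _).trans ?_)
    rw [abs_mul]
    refine mul_le_mul ?_ (hx j) (abs_nonneg _) (by positivity)
    exact ((L j).le_opNorm c').trans (mul_le_mul_of_nonneg_left hn (norm_nonneg _))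
  have hdiff : ∀ᵐ x ∂μ, ∀ c' ∈ Metric.ball c 1,
      HasFDerivAt (fun c => f x * Real.exp (∑ j, L j c * ψ x j))
        (∑ j, (f x * ψ x j * Real.exp (∑ j, L j c' * ψ x j)) • L j) c' := by
    refine Filter.Eventually.of_forall fun x c' _ => ?_
    have h1 : HasFDerivAt (fun c : H => ∑ j, L j c * ψ x j) (∑ j, ψ x j • L j) c' :=
      HasFDerivAt.fun_sum fun j _ => ((L j).hasFDerivAt).mul_const (ψ x j)
    refine ((h1.exp).const_mul (f x)).congr_fderiv ?_
    simp only [Finset.smul_sum, smul_smul]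
    refine Finset.sum_congr rfl fun j _ => ?_
    congr 1
    ring
  have main := hasFDerivAt_integral_of_dominated_of_fderiv_le (𝕜 := ℝ) (μ := μ)
    (F := fun c x => f x * Real.exp (∑ j, L j c * ψ x j))
    (F' := fun c x => ∑ j, (f x * ψ x j * Real.exp (∑ j, L j c * ψ x j)) • L j) (x₀ := c)
    (Metric.ball_mem_nhds c one_pos)
    (Filter.Eventually.of_forall fun c' =>
      (hf.mul (bddObs_exp_energy hψ fun j => L j c')).meas.aestronglyMeasurable)
    (hf.mul (bddObs_exp_energy hψ fun j => L j c)).integrable hF'i.1 hbound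
    (integrable_const _) hdiff
  exact main.congr_fderiv hF'e

lemma hasFDerivAt_expIntegral [IsFiniteMeasure μ] (hψ : ∀ j, BddObs μ (fun x => ψ x j))
    (hf : BddObs μ f) (c : J → ℝ) :
    HasFDerivAt (expIntegral μ ψ f)
      (∑ j, expIntegral μ ψ (fun x => f x * ψ x j) c •
        (ContinuousLinearMap.proj j : (J → ℝ) →L[ℝ] ℝ)) c :=
  hasFDerivAt_integral_mul_exp hψ hf (fun j => ContinuousLinearMap.proj j) c

lemma hasDerivAt_expIntegral [IsFiniteMeasure μ] (hψ : ∀ j, BddObs μ (fun x => ψ x j))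
    (hf : BddObs μ f) {c : ℝ → J → ℝ} {c' : J → ℝ} {r : ℝ} (hc : HasDerivAt c c' r) :
    HasDerivAt (fun r => expIntegral μ ψ f (c r))
      (∑ j, c' j * expIntegral μ ψ (fun x => f x * ψ x j) (c r)) r := by
  refine ((hasFDerivAt_expIntegral hψ hf (c r)).comp_hasDerivAt r hc).congr_deriv ?_
  simp [mul_comm]

lemma gibbsAvg_eq_div (c : J → ℝ) :
    gibbsAvg μ ψ f c = expIntegral μ ψ f c / expIntegral μ ψ (fun _ => 1) c := by
  simp only [gibbsAvg, gibbsMeasure, expIntegral, integral_tilted, smul_eq_mul, one_mul]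
  rw [← integral_div]
  congr 1
  ext x
  ring

lemma gibbsAvg_const_mul (a : ℝ) (c : J → ℝ) :
    gibbsAvg μ ψ (fun x => a * f x) c = a * gibbsAvg μ ψ f c :=
  integral_const_mul _ _

/-- Jensen's inequality for the square. -/
lemma sq_integral_le {ν : Measure E} [IsProbabilityMeasure ν] {f : E → ℝ} (h₁ : Integrable f ν)
    (h₂ : Integrable (fun x => f x * f x) ν) :
    (∫ x, f x ∂ν) ^ 2 ≤ ∫ x, f x * f x ∂ν := by
  set m := ∫ x, f x ∂ν with hm
  have h : 0 ≤ ∫ x, (f x * f x - 2 * m * f x + m ^ 2) ∂ν :=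
    integral_nonneg fun x => by
      simp only [Pi.zero_apply]
      nlinarith [sq_nonneg (f x - m)]
  rw [integral_add (f := fun x => f x * f x - 2 * m * f x) (h₂.sub (h₁.const_mul _))
    (integrable_const _), integral_sub h₂ (h₁.const_mul _), integral_const_mul,
    integral_const, ← hm] at h
  simp only [probReal_univ, one_smul] at h
  nlinarith

section Prob

variable [IsProbabilityMeasure μ]

lemma expIntegral_one_pos (hψ : ∀ j, BddObs μ (fun x => ψ x j)) (c : J → ℝ) :
    0 < expIntegral μ ψ (fun _ => 1) c := by
  simp only [expIntegral, one_mul]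
  exact integral_exp_pos (bddObs_exp_energy hψ c).integrable

lemma isProbabilityMeasure_gibbsMeasure (hψ : ∀ j, BddObs μ (fun x => ψ x j)) (c : J → ℝ) :
    IsProbabilityMeasure (gibbsMeasure μ ψ c) :=
  isProbabilityMeasure_tilted (bddObs_exp_energy hψ c).integrable

lemma hasDerivAt_log_expIntegral (hψ : ∀ j, BddObs μ (fun x => ψ x j))
    {c : ℝ → J → ℝ} {c' : J → ℝ} {r : ℝ} (hc : HasDerivAt c c' r) :
    HasDerivAt (fun r => Real.log (expIntegral μ ψ (fun _ => 1) (c r)))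
      (∑ j, c' j * gibbsAvg μ ψ (fun x => ψ x j) (c r)) r := by
  refine ((hasDerivAt_expIntegral hψ (BddObs.const μ 1) hc).log
    (expIntegral_one_pos hψ _).ne').congr_deriv ?_
  simp only [gibbsAvg_eq_div, one_mul, Finset.sum_div, mul_div_assoc]

/-- The derivative of a Gibbs average is a covariance under the Gibbs measure. -/
lemma hasDerivAt_gibbsAvg (hψ : ∀ j, BddObs μ (fun x => ψ x j)) (hf : BddObs μ f)
    {c : ℝ → J → ℝ} {c' : J → ℝ} {r : ℝ} (hc : HasDerivAt c c' r) :
    HasDerivAt (fun r => gibbsAvg μ ψ f (c r))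
      (∑ j, c' j * (gibbsAvg μ ψ (fun x => f x * ψ x j) (c r)
        - gibbsAvg μ ψ f (c r) * gibbsAvg μ ψ (fun x => ψ x j) (c r))) r := by
  have hZ := (expIntegral_one_pos hψ (c r)).ne'
  simp only [gibbsAvg_eq_div]
  refine ((hasDerivAt_expIntegral hψ hf hc).fun_div
    (hasDerivAt_expIntegral hψ (BddObs.const μ 1) hc) hZ).congr_deriv ?_
  simp only [one_mul, mul_sub, Finset.sum_sub_distrib]
  rw [sub_div, Finset.sum_mul, Finset.sum_div, Finset.mul_sum, Finset.sum_div]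
  congr 1 <;> refine Finset.sum_congr rfl fun j _ => ?_ <;> field_simp

lemma continuous_expIntegral (hψ : ∀ j, BddObs μ (fun x => ψ x j)) (hf : BddObs μ f) :
    Continuous (expIntegral μ ψ f) :=
  continuous_iff_continuousAt.2 fun c => (hasFDerivAt_expIntegral hψ hf c).continuousAt

lemma continuous_gibbsAvg (hψ : ∀ j, BddObs μ (fun x => ψ x j)) (hf : BddObs μ f) :
    Continuous (gibbsAvg μ ψ f) := by
  have : gibbsAvg μ ψ f = fun c => expIntegral μ ψ f c / expIntegral μ ψ (fun _ => 1) c :=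
    funext gibbsAvg_eq_div
  rw [this]
  exact (continuous_expIntegral hψ hf).div (continuous_expIntegral hψ (BddObs.const μ 1))
    fun c => (expIntegral_one_pos hψ c).ne'

/-- The bound on a Gibbs average is uniform in the coefficients. -/
lemma abs_gibbsAvg_le (hψ : ∀ j, BddObs μ (fun x => ψ x j)) {K : ℝ}
    (hK : ∀ᵐ x ∂μ, |f x| ≤ K) (c : J → ℝ) : |gibbsAvg μ ψ f c| ≤ K := by
  have := isProbabilityMeasure_gibbsMeasure hψ c
  have h := norm_integral_le_of_norm_le_const (μ := gibbsMeasure μ ψ c) (f := f) (C := K)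
    ((gibbsMeasure_ac c).ae_le hK)
  simpa [gibbsAvg] using h

lemma abs_log_expIntegral_le (hψ : ∀ j, BddObs μ (fun x => ψ x j)) {B : ℝ}
    (hb : ∀ᵐ x ∂μ, ∀ j, |ψ x j| ≤ B) (c : J → ℝ) :
    |Real.log (expIntegral μ ψ (fun _ => 1) c)| ≤ B * ∑ j, |c j| := by
  have hi := (bddObs_exp_energy hψ c).integrable
  have hE : ∀ᵐ x ∂μ, |∑ j, c j * ψ x j| ≤ B * ∑ j, |c j| := by
    filter_upwards [hb] with x hx
    rw [Finset.mul_sum]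
    refine (Finset.abs_sum_le_sum_abs _ _).trans (Finset.sum_le_sum fun j _ => ?_)
    rw [abs_mul, mul_comm]
    exact mul_le_mul_of_nonneg_right (hx j) (abs_nonneg _)
  have hpos := expIntegral_one_pos hψ c
  have h1 : expIntegral μ ψ (fun _ => 1) c ≤ Real.exp (B * ∑ j, |c j|) := by
    have := integral_mono_ae hi (integrable_const (Real.exp (B * ∑ j, |c j|)))
      (hE.mono fun x hx => Real.exp_le_exp.2 ((le_abs_self _).trans hx))
    simpa [expIntegral] using this
  have h2 : Real.exp (-(B * ∑ j, |c j|)) ≤ expIntegral μ ψ (fun _ => 1) c := by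
    have := integral_mono_ae (integrable_const (Real.exp (-(B * ∑ j, |c j|)))) hi
      (hE.mono fun x hx => Real.exp_le_exp.2 (neg_le_of_abs_le hx))
    simpa [expIntegral] using this
  rw [abs_le]
  exact ⟨(Real.le_log_iff_exp_le hpos).2 h2, (Real.log_le_iff_le_exp hpos).2 h1⟩

lemma gibbsAvg_sum (hψ : ∀ j, BddObs μ (fun x => ψ x j)) {ι : Type*} (s : Finset ι) {F : ι → E → ℝ}
    (hF : ∀ i ∈ s, BddObs μ (F i)) (c : J → ℝ) :
    gibbsAvg μ ψ (fun x => ∑ i ∈ s, F i x) c = ∑ i ∈ s, gibbsAvg μ ψ (F i) c := by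
  have := isProbabilityMeasure_gibbsMeasure hψ c
  exact integral_finsetSum _ fun i hi => ((hF i hi).mono_ac (gibbsMeasure_ac c)).integrable

lemma sq_gibbsAvg_le (hψ : ∀ j, BddObs μ (fun x => ψ x j)) (hf : BddObs μ f) (c : J → ℝ) :
    gibbsAvg μ ψ f c ^ 2 ≤ gibbsAvg μ ψ (fun x => f x * f x) c := by
  have := isProbabilityMeasure_gibbsMeasure hψ c
  have h := sq_integral_le (hf.mono_ac (gibbsMeasure_ac (ψ := ψ) c)).integrable
    ((hf.mul hf).mono_ac (gibbsMeasure_ac c)).integrable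
  exact h

end Prob

end Gibbs

/-! ### The planted Gaussian channel -/

section Planted

variable {E κ : Type*} [MeasurableSpace E]

/-- The joint law of the signal, distributed as `μ`, and of the independent standard Gaussian
noise. -/
noncomputable def plantedLaw (μ : Measure E) (κ : Type*) [Fintype κ] : Measure (E × (κ → ℝ)) :=
  μ.prod (stdGaussianPi κ)

instance [Fintype κ] (μ : Measure E) [IsProbabilityMeasure μ] :
    IsProbabilityMeasure (plantedLaw μ κ) := by
  unfold plantedLaw; infer_instance

/-- A family of functions of the signal and the noise that is bounded uniformly in the parameter
and in the noise, for almost every signal. -/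
structure BddFam (μ : Measure E) {ι : Type*} (h : ι → E × (κ → ℝ) → ℝ) : Prop where
  meas : ∀ i, Measurable (h i)
  bdd : ∃ K, 0 ≤ K ∧ ∀ᵐ x ∂μ, ∀ i g, |h i (x, g)| ≤ K

namespace BddFam

variable {μ : Measure E} {ι : Type*} {h h₁ h₂ : ι → E × (κ → ℝ) → ℝ}

lemma mul (H₁ : BddFam μ h₁) (H₂ : BddFam μ h₂) : BddFam μ (fun i ω => h₁ i ω * h₂ i ω) := by
  obtain ⟨K, hK0, hK⟩ := H₁.bdd
  obtain ⟨L, hL0, hL⟩ := H₂.bdd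
  refine ⟨fun i => (H₁.meas i).mul (H₂.meas i), K * L, by positivity, ?_⟩
  filter_upwards [hK, hL] with x h1 h2 i g
  rw [abs_mul]
  exact mul_le_mul (h1 i g) (h2 i g) (abs_nonneg _) hK0

lemma add (H₁ : BddFam μ h₁) (H₂ : BddFam μ h₂) : BddFam μ (fun i ω => h₁ i ω + h₂ i ω) := by
  obtain ⟨K, hK0, hK⟩ := H₁.bdd
  obtain ⟨L, hL0, hL⟩ := H₂.bdd
  refine ⟨fun i => (H₁.meas i).add (H₂.meas i), K + L, by positivity, ?_⟩
  filter_upwards [hK, hL] with x h1 h2 i g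
  exact (abs_add_le _ _).trans (add_le_add (h1 i g) (h2 i g))

lemma const (a : ℝ) : BddFam μ (fun (_ : ι) (_ : E × (κ → ℝ)) => a) :=
  ⟨fun _ => measurable_const, |a|, abs_nonneg _,
    Filter.Eventually.of_forall fun _ _ _ => le_rfl⟩

lemma const_mul (a : ℝ) (H : BddFam μ h) : BddFam μ (fun i ω => a * h i ω) := (const a).mul H

lemma div_const (H : BddFam μ h) (a : ℝ) : BddFam μ (fun i ω => h i ω / a) := by
  simpa only [div_eq_inv_mul] using H.const_mul a⁻¹

lemma sub (H₁ : BddFam μ h₁) (H₂ : BddFam μ h₂) : BddFam μ (fun i ω => h₁ i ω - h₂ i ω) := by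
  simpa [sub_eq_add_neg] using H₁.add (H₂.const_mul (-1))

lemma sum {α : Type*} (t : Finset α) {h : α → ι → E × (κ → ℝ) → ℝ} (H : ∀ a, BddFam μ (h a)) :
    BddFam μ (fun i ω => ∑ a ∈ t, h a i ω) := by
  classical
  induction t using Finset.induction_on with
  | empty => simpa using const 0
  | insert a t ha ih => simpa [Finset.sum_insert ha] using (H a).add ih

lemma signal {f : E → ℝ} (hf : BddObs μ f) :
    BddFam μ (fun (_ : ι) (ω : E × (κ → ℝ)) => f ω.1) := by
  obtain ⟨K, hK⟩ := hf.bdd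
  exact ⟨fun _ => hf.meas.comp measurable_fst, |K|, abs_nonneg _,
    hK.mono fun x hx _ _ => hx.trans (le_abs_self _)⟩

variable [Fintype κ]

lemma ae_bound [IsProbabilityMeasure μ] (H : BddFam μ h) :
    ∃ K, 0 ≤ K ∧ ∀ᵐ ω ∂(plantedLaw μ κ), ∀ i, |h i ω| ≤ K := by
  obtain ⟨K, hK0, hK⟩ := H.bdd
  refine ⟨K, hK0, ?_⟩
  have := (Measure.quasiMeasurePreserving_fst (μ := μ) (ν := stdGaussianPi κ)).ae hK
  filter_upwards [this] with ω hω i using hω i ω.2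

variable [IsProbabilityMeasure μ]

lemma integrable (H : BddFam μ h) (i : ι) : Integrable (h i) (plantedLaw μ κ) := by
  obtain ⟨K, _, hK⟩ := H.ae_bound
  exact Integrable.of_bound (H.meas i).aestronglyMeasurable K (hK.mono fun ω hω => hω i)

lemma memLp_coord (k : κ) : MemLp (fun ω : E × (κ → ℝ) => ω.2 k) 2 (plantedLaw μ κ) := by
  have h1 : MeasurePreserving (fun ω : E × (κ → ℝ) => ω.2 k) (plantedLaw μ κ)
      (gaussianReal 0 1) :=
    (measurePreserving_eval_stdGaussianPi k).comp
      (measurePreserving_snd (μ := μ) (ν := stdGaussianPi κ))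
  exact (memLp_id_gaussianReal 2).comp_measurePreserving h1

lemma memLp (H : BddFam μ h) (i : ι) : MemLp (h i) 2 (plantedLaw μ κ) := by
  obtain ⟨K, _, hK⟩ := H.ae_bound
  exact MemLp.of_bound (H.meas i).aestronglyMeasurable K (hK.mono fun ω hω => hω i)

lemma memLp_coord_mul (H : BddFam μ h) (i : ι) (k : κ) :
    MemLp (fun ω => ω.2 k * h i ω) 2 (plantedLaw μ κ) := by
  obtain ⟨K, _, hK⟩ := H.ae_bound
  refine MemLp.of_le_mul (c := K) (memLp_coord (μ := μ) k)
    (((measurable_pi_apply k).comp measurable_snd).mul (H.meas i)).aestronglyMeasurable ?_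
  filter_upwards [hK] with ω hω
  rw [norm_mul, mul_comm]
  exact mul_le_mul_of_nonneg_right (hω i) (norm_nonneg _)

lemma integrable_coord_mul (H : BddFam μ h) (i : ι) (k : κ) :
    Integrable (fun ω => ω.2 k * h i ω) (plantedLaw μ κ) :=
  (H.memLp_coord_mul i k).integrable one_le_two

/-- Gaussian integration by parts under the planted law. -/
lemma integral_coord_mul [DecidableEq κ] {h h' : ι → E × (κ → ℝ) → ℝ} (H : BddFam μ h)
    (H' : BddFam μ h') (i : ι) (k : κ)
    (hd : ∀ x g, HasDerivAt (fun r => h i (x, Function.update g k r)) (h' i (x, g)) (g k)) :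
    ∫ ω, ω.2 k * h i ω ∂(plantedLaw μ κ) = ∫ ω, h' i ω ∂(plantedLaw μ κ) := by
  obtain ⟨K, _, hK⟩ := H.bdd
  obtain ⟨L, _, hL⟩ := H'.bdd
  have e1 := integral_prod (μ := μ) (ν := stdGaussianPi κ) _ (H.integrable_coord_mul i k)
  have e2 := integral_prod (μ := μ) (ν := stdGaussianPi κ) _ (H'.integrable i)
  rw [plantedLaw, e1, e2]
  refine integral_congr_ae ?_
  filter_upwards [hK, hL] with x h1 h2
  exact integral_coord_mul_stdGaussianPi (K := max K L) k (hd x)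
    ((H.meas i).comp measurable_prodMk_left) (fun g => (h1 i g).trans (le_max_left _ _))
    ((H'.meas i).comp measurable_prodMk_left) (fun g => (h2 i g).trans (le_max_right _ _))

end BddFam

/-- The sufficient statistics of the channel: the features `φ k` and their squares. -/
def features (φ : E → κ → ℝ) (x : E) : κ ⊕ κ → ℝ :=
  Sum.elim (φ x) fun k => φ x k * φ x k

/-- The coefficients of the sufficient statistics in the energy
`∑ k, (√s_k g_k φ_k + s_k φ_k u_k - s_k φ_k² / 2)`, where `s` is the vector of signal strengths,
`g` the noise and `u` the features of the signal. -/
noncomputable def coeffs (s g u : κ → ℝ) : κ ⊕ κ → ℝ :=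
  Sum.elim (fun k => √(s k) * g k + s k * u k) fun k => -(s k / 2)

/-- The coefficients of the energy as a function of the disorder. -/
noncomputable def obs (φ : E → κ → ℝ) (s : κ → ℝ) (ω : E × (κ → ℝ)) : κ ⊕ κ → ℝ :=
  coeffs s ω.2 (φ ω.1)

/-- The Gibbs average of `f` as a function of the signal strengths and of the disorder. -/
noncomputable def gav [Fintype κ] (μ : Measure E) (φ : E → κ → ℝ) (f : E → ℝ) (s : κ → ℝ)
    (ω : E × (κ → ℝ)) : ℝ :=
  gibbsAvg μ (features φ) f (obs φ s ω)

variable {μ : Measure E} {φ : E → κ → ℝ}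

lemma bddObs_features (hφ : ∀ k, BddObs μ (fun x => φ x k)) (j : κ ⊕ κ) :
    BddObs μ (fun x => features φ x j) := by
  cases j with
  | inl k => exact hφ k
  | inr k => exact (hφ k).mul (hφ k)

lemma measurable_coeffs (s u : κ → ℝ) : Measurable (fun g => coeffs s g u) := by
  refine measurable_pi_iff.2 fun j => ?_
  cases j <;> simp only [coeffs, Sum.elim_inl, Sum.elim_inr] <;> fun_prop

lemma measurable_obs (hφ : ∀ k, BddObs μ (fun x => φ x k)) (s : κ → ℝ) :
    Measurable (obs φ s) := by
  have := fun k => (hφ k).meas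
  refine measurable_pi_iff.2 fun j => ?_
  cases j <;> simp only [obs, coeffs, Sum.elim_inl, Sum.elim_inr] <;> fun_prop

lemma sum_coeffs_mul_features {E κ : Type*} [Fintype κ] {φ : E → κ → ℝ} (c : κ ⊕ κ → ℝ) (x : E) :
    ∑ j, c j * features φ x j
      = ∑ k, (c (.inl k) * φ x k + c (.inr k) * (φ x k * φ x k)) := by
  simp [features, Fintype.sum_sum_type, Finset.sum_add_distrib]

variable [Fintype κ] [IsProbabilityMeasure μ]

lemma BddFam.gav (hφ : ∀ k, BddObs μ (fun x => φ x k)) {f : E → ℝ} (hf : BddObs μ f)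
    {ι : Type*} (s : ι → κ → ℝ) : BddFam μ (fun i ω => gav μ φ f (s i) ω) := by
  obtain ⟨K, hK⟩ := hf.bdd
  exact ⟨fun i => (continuous_gibbsAvg (bddObs_features hφ) hf).measurable.comp
      (measurable_obs hφ _), |K|, abs_nonneg _, Filter.Eventually.of_forall fun x i g =>
      (abs_gibbsAvg_le (bddObs_features hφ) hK _).trans (le_abs_self _)⟩

/-- The shift that turns the noise into the observation changes the law of the noise by the
likelihood `exp(c · ψ)`, whose coefficients are those of a vanishing signal. -/
lemma integral_plantedLaw_obs (hφ : ∀ k, BddObs μ (fun x => φ x k)) {s : κ → ℝ}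
    (hs : ∀ k, 0 ≤ s k) {f : E → ℝ} (hf : BddObs μ f) {G : (κ ⊕ κ → ℝ) → ℝ} (hG : Measurable G)
    {K : ℝ} (hK : ∀ c, |G c| ≤ K) :
    ∫ ω, f ω.1 * G (obs φ s ω) ∂(plantedLaw μ κ)
      = ∫ g, G (coeffs s g 0) * expIntegral μ (features φ) f (coeffs s g 0)
          ∂(stdGaussianPi κ) := by
  have hφm := fun k => (hφ k).meas
  obtain ⟨L, hL⟩ := hf.bdd
  have hL' := (Measure.quasiMeasurePreserving_fst (μ := μ) (ν := stdGaussianPi κ)).ae hL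
  set b : E → κ → ℝ := fun x k => √(s k) * φ x k with hb
  set lik : E × (κ → ℝ) → ℝ := fun p => ∏ k, Real.exp (b p.1 k * p.2 k - b p.1 k ^ 2 / 2) with hlik
  have hlikm : Measurable lik := by
    simp only [hlik, hb]; fun_prop
  have hobs : ∀ x g, obs φ s (x, g) = coeffs s (g + b x) 0 := by
    intro x g
    ext j
    cases j with
    | inl k =>
      simp only [obs, coeffs, Sum.elim_inl, hb, Pi.add_apply, Pi.zero_apply]
      rw [mul_add, ← mul_assoc, Real.mul_self_sqrt (hs k)]
      ring
    | inr k => rfl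
  have hexp : ∀ x g, lik (x, g) = Real.exp (∑ j, coeffs s g 0 j * features φ x j) := by
    intro x g
    rw [sum_coeffs_mul_features, Real.exp_sum]
    refine Finset.prod_congr rfl fun k _ => ?_
    congr 1
    simp only [hb, coeffs, Sum.elim_inl, Sum.elim_inr, Pi.zero_apply, mul_pow,
      Real.sq_sqrt (hs k)]
    ring
  have hliki : Integrable lik (μ.prod (stdGaussianPi κ)) := by
    rw [integrable_prod_iff hlikm.aestronglyMeasurable]
    have h1 : ∀ x, ∫ g, ‖lik (x, g)‖ ∂(stdGaussianPi κ) = 1 := by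
      intro x
      have h := integral_add_stdGaussianPi (b x) (measurable_const (a := (1 : ℝ)))
      simp only [mul_one, integral_const, probReal_univ, smul_eq_mul] at h
      rw [h]
      refine integral_congr_ae (Filter.Eventually.of_forall fun g => ?_)
      exact Real.norm_of_nonneg (Finset.prod_nonneg fun k _ => (Real.exp_pos _).le)
    refine ⟨Filter.Eventually.of_forall fun x => integrable_exp_shift (b x), ?_⟩
    simp only [h1]
    exact integrable_const _
  have hGm : Measurable (fun g => G (coeffs s g 0)) := hG.comp (measurable_coeffs s 0)
  have hfull : Integrable (fun p : E × (κ → ℝ) => lik p * (f p.1 * G (coeffs s p.2 0)))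
      (μ.prod (stdGaussianPi κ)) := by
    refine hliki.mul_bdd (c := L * K)
      ((hf.meas.comp measurable_fst).mul (hGm.comp measurable_snd)).aestronglyMeasurable ?_
    filter_upwards [hL'] with p hp
    rw [norm_mul]
    exact mul_le_mul hp (hK _) (abs_nonneg _) ((abs_nonneg _).trans hp)
  have hint : Integrable (fun ω : E × (κ → ℝ) => f ω.1 * G (obs φ s ω))
      (μ.prod (stdGaussianPi κ)) := by
    refine Integrable.of_bound ((hf.meas.comp measurable_fst).mul
      (hG.comp (measurable_obs hφ s))).aestronglyMeasurable (L * K) ?_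
    filter_upwards [hL'] with p hp
    rw [norm_mul]
    exact mul_le_mul hp (hK _) (abs_nonneg _) ((abs_nonneg _).trans hp)
  calc ∫ ω, f ω.1 * G (obs φ s ω) ∂(plantedLaw μ κ)
      = ∫ x, ∫ g, f x * G (obs φ s (x, g)) ∂(stdGaussianPi κ) ∂μ := integral_prod _ hint
    _ = ∫ x, ∫ g, lik (x, g) * (f x * G (coeffs s g 0)) ∂(stdGaussianPi κ) ∂μ := by
        congr 1
        ext x
        simp only [hobs]
        exact integral_add_stdGaussianPi (b x) (G := fun g => f x * G (coeffs s g 0))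
          (hGm.const_mul _)
    _ = ∫ g, ∫ x, lik (x, g) * (f x * G (coeffs s g 0)) ∂μ ∂(stdGaussianPi κ) :=
        integral_integral_swap hfull
    _ = _ := by
        congr 1
        ext g
        rw [expIntegral, ← integral_const_mul]
        congr 1
        ext x
        rw [hexp]
        ring

/-- The Nishimori identity: given the observation, the signal is distributed as a sample of the
Gibbs measure. -/
lemma nishimori (hφ : ∀ k, BddObs μ (fun x => φ x k)) {s : κ → ℝ} (hs : ∀ k, 0 ≤ s k)
    {f : E → ℝ} (hf : BddObs μ f) {G : (κ ⊕ κ → ℝ) → ℝ} (hG : Measurable G) {K : ℝ}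
    (hK : ∀ c, |G c| ≤ K) :
    ∫ ω, f ω.1 * G (obs φ s ω) ∂(plantedLaw μ κ)
      = ∫ ω, gav μ φ f s ω * G (obs φ s ω) ∂(plantedLaw μ κ) := by
  obtain ⟨L, hL⟩ := hf.bdd
  have hψ := bddObs_features hφ
  have h2 := integral_plantedLaw_obs hφ hs (BddObs.const μ 1)
    (G := fun c => gibbsAvg μ (features φ) f c * G c)
    ((continuous_gibbsAvg hψ hf).measurable.mul hG) (K := |L| * K) (fun c => by
      rw [abs_mul]
      exact mul_le_mul ((abs_gibbsAvg_le hψ hL c).trans (le_abs_self _)) (hK c) (abs_nonneg _)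
        (abs_nonneg _))
  simp only [one_mul] at h2
  rw [integral_plantedLaw_obs hφ hs hf hG hK]
  refine Eq.trans ?_ h2.symm
  congr 1
  ext g
  rw [gibbsAvg_eq_div]
  have := (expIntegral_one_pos hψ (coeffs s g 0)).ne'
  field_simp

/-- The derivative of a Gibbs average with respect to a coordinate of the noise. -/
lemma hasDerivAt_gav_update [DecidableEq κ] (hφ : ∀ k, BddObs μ (fun x => φ x k)) {f : E → ℝ}
    (hf : BddObs μ f) (s : κ → ℝ) (k : κ) (x : E) (g : κ → ℝ) :
    HasDerivAt (fun r => gav μ φ f s (x, Function.update g k r))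
      (√(s k) * (gav μ φ (fun x => f x * φ x k) s (x, g)
        - gav μ φ f s (x, g) * gav μ φ (fun x => φ x k) s (x, g))) (g k) := by
  have hc : HasDerivAt (fun r => obs φ s (x, Function.update g k r))
      (Sum.elim (Pi.single k √(s k)) 0) (g k) := by
    rw [hasDerivAt_pi]
    intro j
    cases j with
    | inl l =>
      simp only [obs, coeffs, Sum.elim_inl]
      have h1 : HasDerivAt (fun r => Function.update g k r l) ((Pi.single k 1 : κ → ℝ) l) (g k) :=
        (hasDerivAt_pi.1 (hasDerivAt_update g k (g k))) l
      refine ((h1.const_mul √(s l)).add_const (s l * φ x l)).congr_deriv ?_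
      by_cases h : l = k
      · subst h; simp
      · simp [h]
    | inr l =>
      simp only [obs, coeffs, Sum.elim_inr]
      exact hasDerivAt_const _ _
  refine (hasDerivAt_gibbsAvg (bddObs_features hφ) hf hc).congr_deriv ?_
  simp only [Fintype.sum_sum_type, Sum.elim_inl, Sum.elim_inr, Pi.zero_apply, zero_mul,
    Finset.sum_const_zero, add_zero, Function.update_eq_self]
  rw [Finset.sum_eq_single k (fun l _ hl => by simp [hl]) (by simp)]
  simp [gav, features]

end Planted

/-! ### Derivatives in the signal strength -/

section PlantedDerivatives

variable {E κ : Type*} [MeasurableSpace E]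

/-- Signal strengths moving along a line: `s_k = σ_k + a_k θ`. -/
def strength (σ a : κ → ℝ) (θ : ℝ) (k : κ) : ℝ := σ k + a k * θ

/-- The derivative in `θ` of `√(σ_k + a_k θ)`, equal to zero where `a_k = 0`. -/
noncomputable def sqrtSlope (σ a : κ → ℝ) (θ : ℝ) (k : κ) : ℝ := a k / (2 * √(strength σ a θ k))

section Strength

variable {σ a : κ → ℝ}

lemma strength_nonneg (hσ : ∀ k, 0 ≤ σ k) (ha : ∀ k, 0 ≤ a k) {θ : ℝ} (hθ : 0 ≤ θ) (k : κ) :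
    0 ≤ strength σ a θ k := add_nonneg (hσ k) (mul_nonneg (ha k) hθ)

lemma strength_pos (hσ : ∀ k, 0 ≤ σ k) (ha : ∀ k, 0 ≤ a k) {θ : ℝ} (hθ : 0 < θ) {k : κ}
    (hk : a k ≠ 0) : 0 < strength σ a θ k :=
  add_pos_of_nonneg_of_pos (hσ k) (mul_pos (lt_of_le_of_ne (ha k) hk.symm) hθ)

lemma sqrtSlope_nonneg (ha : ∀ k, 0 ≤ a k) (θ : ℝ) (k : κ) : 0 ≤ sqrtSlope σ a θ k :=
  div_nonneg (ha k) (by positivity)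

lemma sqrtSlope_mul_sqrt (hσ : ∀ k, 0 ≤ σ k) (ha : ∀ k, 0 ≤ a k) {θ : ℝ} (hθ : 0 < θ) (k : κ) :
    sqrtSlope σ a θ k * √(strength σ a θ k) = a k / 2 := by
  by_cases hk : a k = 0
  · simp [sqrtSlope, hk]
  · have := (Real.sqrt_pos.2 (strength_pos hσ ha hθ hk)).ne'
    rw [sqrtSlope]
    field_simp

lemma hasDerivAt_strength (σ a : κ → ℝ) (θ : ℝ) (k : κ) :
    HasDerivAt (fun θ => strength σ a θ k) (a k) θ :=
  (((hasDerivAt_id θ).const_mul (a k)).const_add (σ k)).congr_deriv (mul_one _)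

lemma hasDerivAt_sqrt_strength (hσ : ∀ k, 0 ≤ σ k) (ha : ∀ k, 0 ≤ a k) {θ : ℝ} (hθ : 0 < θ)
    (k : κ) : HasDerivAt (fun θ => √(strength σ a θ k)) (sqrtSlope σ a θ k) θ := by
  by_cases hk : a k = 0
  · simp only [strength, sqrtSlope, hk, zero_mul, zero_div]
    exact hasDerivAt_const _ _
  · exact (hasDerivAt_strength σ a θ k).sqrt (strength_pos hσ ha hθ hk).ne'

lemma hasDerivAt_coeffs (hσ : ∀ k, 0 ≤ σ k) (ha : ∀ k, 0 ≤ a k) {θ : ℝ} (hθ : 0 < θ)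
    (g u : κ → ℝ) :
    HasDerivAt (fun θ => coeffs (strength σ a θ) g u)
      (Sum.elim (fun k => sqrtSlope σ a θ k * g k + a k * u k) fun k => -(a k / 2)) θ := by
  have h1 := hasDerivAt_strength σ a θ
  rw [hasDerivAt_pi]
  intro j
  cases j with
  | inl k =>
    exact ((hasDerivAt_sqrt_strength hσ ha hθ k).mul_const (g k)).add ((h1 k).mul_const (u k))
  | inr k => exact ((h1 k).div_const 2).neg

lemma continuous_coeffs (g u : κ → ℝ) :
    Continuous (fun θ => coeffs (strength σ a θ) g u) := by
  refine continuous_pi fun j => ?_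
  cases j <;> simp only [coeffs, strength, Sum.elim_inl, Sum.elim_inr] <;> fun_prop

end Strength

variable [Fintype κ] (μ : Measure E) (φ : E → κ → ℝ)

/-- The first Gibbs moment `⟨φ_k⟩`. -/
noncomputable def gm (k : κ) (s : κ → ℝ) (ω : E × (κ → ℝ)) : ℝ := gav μ φ (fun x => φ x k) s ω

/-- The second Gibbs moment `⟨φ_k φ_l⟩`. -/
noncomputable def gmm (k l : κ) (s : κ → ℝ) (ω : E × (κ → ℝ)) : ℝ :=
  gav μ φ (fun x => φ x k * φ x l) s ω

/-- The third Gibbs moment `⟨φ_k φ_l²⟩`. -/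
noncomputable def gmmm (k l : κ) (s : κ → ℝ) (ω : E × (κ → ℝ)) : ℝ :=
  gav μ φ (fun x => φ x k * (φ x l * φ x l)) s ω

/-- The Gibbs covariance of `φ_k` and `φ_l`. -/
noncomputable def gcov (k l : κ) (s : κ → ℝ) (ω : E × (κ → ℝ)) : ℝ :=
  gmm μ φ k l s ω - gm μ φ k s ω * gm μ φ l s ω

/-- The log-partition function of the channel. -/
noncomputable def logZ (s : κ → ℝ) (ω : E × (κ → ℝ)) : ℝ :=
  Real.log (expIntegral μ (features φ) (fun _ => 1) (obs φ s ω))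

/-- The derivative of the log-partition function in `θ`. -/
noncomputable def dlogZ (σ a : κ → ℝ) (θ : ℝ) (ω : E × (κ → ℝ)) : ℝ :=
  ∑ k, (sqrtSlope σ a θ k * (ω.2 k * gm μ φ k (strength σ a θ) ω)
    + a k * (φ ω.1 k * gm μ φ k (strength σ a θ) ω - gmm μ φ k k (strength σ a θ) ω / 2))

variable {μ φ} {σ a : κ → ℝ}

lemma eventually_sqrtSlope_le (hσ : ∀ k, 0 ≤ σ k) (ha : ∀ k, 0 ≤ a k) {θ : ℝ} (hθ : 0 < θ) :
    ∀ᶠ θ' in 𝓝 θ, 0 < θ' ∧ ∀ k, sqrtSlope σ a θ' k ≤ sqrtSlope σ a θ k + 1 := by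
  refine (lt_mem_nhds hθ).and (eventually_all.2 fun k => ?_)
  have hc : ContinuousAt (fun θ => sqrtSlope σ a θ k) θ := by
    by_cases hk : a k = 0
    · simp only [sqrtSlope, hk, zero_div]
      exact continuousAt_const
    · have := (Real.sqrt_pos.2 (strength_pos hσ ha hθ hk)).ne'
      exact continuousAt_const.div
        (continuousAt_const.mul (hasDerivAt_sqrt_strength hσ ha hθ k).continuousAt)
        (mul_ne_zero two_ne_zero this)
  exact (hc.eventually_lt_const (lt_add_one _)).mono fun _ h => h.le

variable [IsProbabilityMeasure μ]

/-- The derivative holds for every `ω`, including those whose signal lies outside the support of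
`μ`. -/
lemma hasDerivAt_logZ (hφ : ∀ k, BddObs μ (fun x => φ x k))
    (hσ : ∀ k, 0 ≤ σ k) (ha : ∀ k, 0 ≤ a k) {θ : ℝ} (hθ : 0 < θ) (ω : E × (κ → ℝ)) :
    HasDerivAt (fun θ => logZ μ φ (strength σ a θ) ω) (dlogZ μ φ σ a θ ω) θ := by
  refine (hasDerivAt_log_expIntegral (bddObs_features hφ)
    (hasDerivAt_coeffs hσ ha hθ ω.2 (φ ω.1))).congr_deriv ?_
  simp only [Fintype.sum_sum_type, Sum.elim_inl, Sum.elim_inr, dlogZ, ← Finset.sum_add_distrib]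
  refine Finset.sum_congr rfl fun k _ => ?_
  simp only [gm, gmm, gav, features, Sum.elim_inl, Sum.elim_inr, obs]
  ring

lemma hasDerivAt_gm (hφ : ∀ k, BddObs μ (fun x => φ x k))
    (hσ : ∀ k, 0 ≤ σ k) (ha : ∀ k, 0 ≤ a k) {θ : ℝ} (hθ : 0 < θ) (ω : E × (κ → ℝ)) (k : κ) :
    HasDerivAt (fun θ => gm μ φ k (strength σ a θ) ω)
      (∑ l, (sqrtSlope σ a θ l * (ω.2 l * gcov μ φ k l (strength σ a θ) ω)
        + a l * (φ ω.1 l * gcov μ φ k l (strength σ a θ) ω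
          - (gmmm μ φ k l (strength σ a θ) ω
            - gm μ φ k (strength σ a θ) ω * gmm μ φ l l (strength σ a θ) ω) / 2))) θ := by
  refine (hasDerivAt_gibbsAvg (bddObs_features hφ) (hφ k)
    (hasDerivAt_coeffs hσ ha hθ ω.2 (φ ω.1))).congr_deriv ?_
  simp only [Fintype.sum_sum_type, Sum.elim_inl, Sum.elim_inr, ← Finset.sum_add_distrib]
  refine Finset.sum_congr rfl fun l _ => ?_
  simp only [gcov, gm, gmm, gmmm, gav, features, Sum.elim_inl, Sum.elim_inr, obs]
  ring

section Families

variable {ι : Type*} (s : ι → κ → ℝ)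

lemma bddFam_gm (hφ : ∀ k, BddObs μ (fun x => φ x k)) (k : κ) :
    BddFam μ (fun i ω => gm μ φ k (s i) ω) := BddFam.gav hφ (hφ k) s

lemma bddFam_gmm (hφ : ∀ k, BddObs μ (fun x => φ x k)) (k l : κ) :
    BddFam μ (fun i ω => gmm μ φ k l (s i) ω) := BddFam.gav hφ ((hφ k).mul (hφ l)) s

lemma bddFam_gmmm (hφ : ∀ k, BddObs μ (fun x => φ x k)) (k l : κ) :
    BddFam μ (fun i ω => gmmm μ φ k l (s i) ω) :=
  BddFam.gav hφ ((hφ k).mul ((hφ l).mul (hφ l))) s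

lemma bddFam_gcov (hφ : ∀ k, BddObs μ (fun x => φ x k)) (k l : κ) :
    BddFam μ (fun i ω => gcov μ φ k l (s i) ω) :=
  (bddFam_gmm s hφ k l).sub ((bddFam_gm s hφ k).mul (bddFam_gm s hφ l))

end Families

/-- Differentiation under the planted expectation when the derivative is the sum of bounded terms
and of products of the noise with bounded terms. -/
lemma hasDerivAt_integral_planted (hσ : ∀ k, 0 ≤ σ k) (ha : ∀ k, 0 ≤ a k) {θ : ℝ} (hθ : 0 < θ)
    {F : ℝ → E × (κ → ℝ) → ℝ} {α β : κ → ℝ → E × (κ → ℝ) → ℝ}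
    (hF : ∀ θ, Measurable (F θ)) (hFi : Integrable (F θ) (plantedLaw μ κ))
    (hα : ∀ k, BddFam μ (α k)) (hβ : ∀ k, BddFam μ (β k))
    (hd : ∀ ω, ∀ θ, 0 < θ → HasDerivAt (fun θ => F θ ω)
      (∑ k, (sqrtSlope σ a θ k * (ω.2 k * α k θ ω) + β k θ ω)) θ) :
    HasDerivAt (fun θ => ∫ ω, F θ ω ∂(plantedLaw μ κ))
      (∑ k, (sqrtSlope σ a θ k * ∫ ω, ω.2 k * α k θ ω ∂(plantedLaw μ κ)
        + ∫ ω, β k θ ω ∂(plantedLaw μ κ))) θ := by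
  have hi : ∀ k, Integrable (fun ω => sqrtSlope σ a θ k * (ω.2 k * α k θ ω) + β k θ ω)
      (plantedLaw μ κ) :=
    fun k => (((hα k).integrable_coord_mul θ k).const_mul _).add ((hβ k).integrable θ)
  choose A hA0 hA using fun k => (hα k).ae_bound
  choose B hB0 hB using fun k => (hβ k).ae_bound
  have key := hasDerivAt_integral_of_dominated_loc_of_deriv_le (μ := plantedLaw μ κ) (x₀ := θ)
    (F := F) (F' := fun θ ω => ∑ k, (sqrtSlope σ a θ k * (ω.2 k * α k θ ω) + β k θ ω))
    (bound := fun ω => ∑ k, ((sqrtSlope σ a θ k + 1) * (‖ω.2 k‖ * A k) + B k))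
    (eventually_sqrtSlope_le hσ ha hθ)
    (Eventually.of_forall fun θ => (hF θ).aestronglyMeasurable) hFi
    (integrable_finsetSum _ fun k _ => hi k).aestronglyMeasurable
    (by
      filter_upwards [ae_all_iff.2 hA, ae_all_iff.2 hB] with ω h1 h2 θ' hθ'
      refine (norm_sum_le _ _).trans (Finset.sum_le_sum fun k _ => ?_)
      refine (norm_add_le _ _).trans (add_le_add ?_ (h2 k θ'))
      rw [norm_mul, norm_mul, Real.norm_of_nonneg (sqrtSlope_nonneg ha θ' k)]
      refine mul_le_mul (hθ'.2 k) ?_ (by positivity)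
        (add_nonneg (sqrtSlope_nonneg ha θ k) zero_le_one)
      exact mul_le_mul_of_nonneg_left (h1 k θ') (norm_nonneg _))
    (integrable_finsetSum _ fun k _ =>
      (((((BddFam.memLp_coord (μ := μ) k).integrable one_le_two).norm).mul_const _).const_mul
        _).add (integrable_const _))
    (Eventually.of_forall fun ω θ' hθ' => hd ω θ' hθ'.1)
  refine key.2.congr_deriv ?_
  rw [integral_finsetSum _ fun k _ => hi k]
  refine Finset.sum_congr rfl fun k _ => ?_
  rw [integral_add (((hα k).integrable_coord_mul θ k).const_mul _) ((hβ k).integrable θ),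
    integral_const_mul]

lemma measurable_logZ (hφ : ∀ k, BddObs μ (fun x => φ x k)) (s : κ → ℝ) :
    Measurable (logZ μ φ s) :=
  ((continuous_expIntegral (bddObs_features hφ) (BddObs.const μ 1)).measurable.comp
    (measurable_obs hφ s)).log

/-- A domination of the log-partition function, uniform for bounded signal strengths. -/
lemma exists_bound_logZ (hφ : ∀ k, BddObs μ (fun x => φ x k)) (R : ℝ) :
    ∃ b : E × (κ → ℝ) → ℝ, Integrable b (plantedLaw μ κ) ∧
      ∀ᵐ ω ∂(plantedLaw μ κ), ∀ s : κ → ℝ, (∀ k, |s k| ≤ R) → |logZ μ φ s ω| ≤ b ω := by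
  obtain ⟨B, hB, hb⟩ := exists_uniform_bound (bddObs_features hφ)
  have hb' : ∀ᵐ ω ∂(plantedLaw μ κ), ∀ j, |features φ ω.1 j| ≤ B :=
    (Measure.quasiMeasurePreserving_fst (μ := μ) (ν := stdGaussianPi κ)).ae hb
  refine ⟨fun ω => B * ((∑ k, (√R * ‖ω.2 k‖ + R * B)) + ∑ _k : κ, R / 2), ?_, ?_⟩
  · refine (Integrable.add ?_ (integrable_const _)).const_mul _
    exact integrable_finsetSum _ fun k _ =>
      ((((BddFam.memLp_coord (μ := μ) k).integrable one_le_two).norm).const_mul _).add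
        (integrable_const _)
  · filter_upwards [hb'] with ω hω s hs
    refine (abs_log_expIntegral_le (bddObs_features hφ) hb _).trans ?_
    refine mul_le_mul_of_nonneg_left ?_ hB
    rw [Fintype.sum_sum_type]
    refine add_le_add (Finset.sum_le_sum fun k _ => ?_) (Finset.sum_le_sum fun k _ => ?_)
    · simp only [obs, coeffs, Sum.elim_inl]
      refine (abs_add_le _ _).trans (add_le_add ?_ ?_)
      · rw [abs_mul, abs_of_nonneg (Real.sqrt_nonneg _)]
        exact mul_le_mul_of_nonneg_right (Real.sqrt_le_sqrt ((le_abs_self _).trans (hs k)))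
          (abs_nonneg _)
      · rw [abs_mul]
        exact mul_le_mul (hs k) (hω (.inl k)) (abs_nonneg _) ((abs_nonneg _).trans (hs k))
    · simp only [obs, coeffs, Sum.elim_inr]
      rw [abs_neg, abs_div, abs_two]
      exact div_le_div_of_nonneg_right (hs k) two_pos.le

lemma integrable_logZ (hφ : ∀ k, BddObs μ (fun x => φ x k)) (s : κ → ℝ) :
    Integrable (logZ μ φ s) (plantedLaw μ κ) := by
  obtain ⟨b, hbi, hb⟩ := exists_bound_logZ hφ (∑ k, |s k|)
  refine hbi.mono' (measurable_logZ hφ s).aestronglyMeasurable ?_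
  filter_upwards [hb] with ω hω using hω s fun k =>
    Finset.single_le_sum (f := fun k => |s k|) (fun _ _ => abs_nonneg _) (Finset.mem_univ k)

lemma abs_strength_le {θ R : ℝ} (hθ : |θ| ≤ R) (k : κ) :
    |strength σ a θ k| ≤ ∑ k, (|σ k| + |a k| * R) := by
  have hR : 0 ≤ R := (abs_nonneg _).trans hθ
  refine le_trans ?_ (Finset.single_le_sum (f := fun k => |σ k| + |a k| * R)
    (fun k _ => by positivity) (Finset.mem_univ k))
  refine (abs_add_le _ _).trans (add_le_add le_rfl ?_)
  rw [abs_mul]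
  exact mul_le_mul_of_nonneg_left hθ (abs_nonneg _)

lemma continuous_logZ (hφ : ∀ k, BddObs μ (fun x => φ x k)) (ω : E × (κ → ℝ)) :
    Continuous (fun θ => logZ μ φ (strength σ a θ) ω) :=
  ((continuous_expIntegral (bddObs_features hφ) (BddObs.const μ 1)).comp
    (continuous_coeffs _ _)).log fun _ => (expIntegral_one_pos (bddObs_features hφ) _).ne'

lemma continuous_integral_logZ (hφ : ∀ k, BddObs μ (fun x => φ x k)) :
    Continuous (fun θ => ∫ ω, logZ μ φ (strength σ a θ) ω ∂(plantedLaw μ κ)) := by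
  refine continuous_iff_continuousAt.2 fun θ => ?_
  obtain ⟨b, hbi, hb⟩ := exists_bound_logZ hφ (∑ k, (|σ k| + |a k| * (|θ| + 1)))
  refine continuousAt_of_dominated (bound := b)
    (Eventually.of_forall fun θ => (measurable_logZ hφ _).aestronglyMeasurable) ?_ hbi
    (Eventually.of_forall fun ω => (continuous_logZ hφ ω).continuousAt)
  have hnear : ∀ᶠ θ' in 𝓝 θ, |θ'| ≤ |θ| + 1 :=
    (continuous_abs.continuousAt.eventually_lt_const (lt_add_one |θ|)).mono fun _ h => h.le
  filter_upwards [hnear] with θ' hθ'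
  filter_upwards [hb] with ω hω using hω _ fun k => abs_strength_le hθ' k

lemma continuous_integral_gm_sq (hφ : ∀ k, BddObs μ (fun x => φ x k)) (k : κ) :
    Continuous (fun θ => ∫ ω, gm μ φ k (strength σ a θ) ω ^ 2 ∂(plantedLaw μ κ)) := by
  have H := (bddFam_gm (strength σ a) hφ k).mul (bddFam_gm (strength σ a) hφ k)
  obtain ⟨K, _, hK⟩ := H.ae_bound
  simp only [pow_two]
  refine continuous_of_dominated (bound := fun _ => K) (fun θ => (H.meas θ).aestronglyMeasurable)
    (fun θ => hK.mono fun ω hω => hω θ) (integrable_const _) (Eventually.of_forall fun ω => ?_)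
  have : Continuous fun θ => gm μ φ k (strength σ a θ) ω :=
    (continuous_gibbsAvg (bddObs_features hφ) (hφ k)).comp (continuous_coeffs _ _)
  exact this.mul this

end PlantedDerivatives

/-! ### Overlap identities under the planted law -/

section Overlaps

variable {E κ : Type*}

/-- The functions of the disorder that are bounded measurable functions of the observation. These
are the functions to which the Nishimori identity applies. -/
def ObsFun (φ : E → κ → ℝ) (s : κ → ℝ) (h : E × (κ → ℝ) → ℝ) : Prop :=
  ∃ G : (κ ⊕ κ → ℝ) → ℝ, Measurable G ∧ (∃ K, ∀ c, |G c| ≤ K) ∧ h = fun ω => G (obs φ s ω)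

lemma ObsFun.mul {φ : E → κ → ℝ} {s : κ → ℝ} {h₁ h₂ : E × (κ → ℝ) → ℝ} (H₁ : ObsFun φ s h₁)
    (H₂ : ObsFun φ s h₂) : ObsFun φ s (fun ω => h₁ ω * h₂ ω) := by
  obtain ⟨G₁, hG₁, ⟨K₁, hK₁⟩, rfl⟩ := H₁
  obtain ⟨G₂, hG₂, ⟨K₂, hK₂⟩, rfl⟩ := H₂
  refine ⟨fun c => G₁ c * G₂ c, hG₁.mul hG₂, ⟨K₁ * K₂, fun c => ?_⟩, rfl⟩
  rw [abs_mul]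
  exact mul_le_mul (hK₁ c) (hK₂ c) (abs_nonneg _) ((abs_nonneg _).trans (hK₁ c))

lemma ObsFun.sub {φ : E → κ → ℝ} {s : κ → ℝ} {h₁ h₂ : E × (κ → ℝ) → ℝ} (H₁ : ObsFun φ s h₁)
    (H₂ : ObsFun φ s h₂) : ObsFun φ s (fun ω => h₁ ω - h₂ ω) := by
  obtain ⟨G₁, hG₁, ⟨K₁, hK₁⟩, rfl⟩ := H₁
  obtain ⟨G₂, hG₂, ⟨K₂, hK₂⟩, rfl⟩ := H₂
  exact ⟨fun c => G₁ c - G₂ c, hG₁.sub hG₂, ⟨K₁ + K₂, fun c =>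
    (abs_sub _ _).trans (add_le_add (hK₁ c) (hK₂ c))⟩, rfl⟩

variable [MeasurableSpace E] [Fintype κ] {μ : Measure E} {φ : E → κ → ℝ} {σ a s : κ → ℝ}
  [IsProbabilityMeasure μ]

lemma ObsFun.gav (hφ : ∀ k, BddObs μ (fun x => φ x k)) {f : E → ℝ} (hf : BddObs μ f) :
    ObsFun φ s (gav μ φ f s) := by
  obtain ⟨K, hK⟩ := hf.bdd
  exact ⟨gibbsAvg μ (features φ) f, (continuous_gibbsAvg (bddObs_features hφ) hf).measurable,
    ⟨K, abs_gibbsAvg_le (bddObs_features hφ) hK⟩, rfl⟩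

lemma obsFun_gm (hφ : ∀ k, BddObs μ (fun x => φ x k)) (k : κ) : ObsFun φ s (gm μ φ k s) :=
  ObsFun.gav hφ (hφ k)

lemma obsFun_gmm (hφ : ∀ k, BddObs μ (fun x => φ x k)) (k l : κ) :
    ObsFun φ s (gmm μ φ k l s) := ObsFun.gav hφ ((hφ k).mul (hφ l))

lemma obsFun_gcov (hφ : ∀ k, BddObs μ (fun x => φ x k)) (k l : κ) :
    ObsFun φ s (gcov μ φ k l s) :=
  (obsFun_gmm hφ k l).sub ((obsFun_gm hφ k).mul (obsFun_gm hφ l))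

lemma nishimori_gm (hφ : ∀ k, BddObs μ (fun x => φ x k)) (hs : ∀ k, 0 ≤ s k) (k : κ)
    {h : E × (κ → ℝ) → ℝ} (H : ObsFun φ s h) :
    ∫ ω, φ ω.1 k * h ω ∂(plantedLaw μ κ) = ∫ ω, gm μ φ k s ω * h ω ∂(plantedLaw μ κ) := by
  obtain ⟨G, hG, ⟨K, hK⟩, rfl⟩ := H
  exact nishimori hφ hs (hφ k) hG hK

lemma nishimori_gmm (hφ : ∀ k, BddObs μ (fun x => φ x k)) (hs : ∀ k, 0 ≤ s k) (k l : κ)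
    {h : E × (κ → ℝ) → ℝ} (H : ObsFun φ s h) :
    ∫ ω, φ ω.1 k * φ ω.1 l * h ω ∂(plantedLaw μ κ)
      = ∫ ω, gmm μ φ k l s ω * h ω ∂(plantedLaw μ κ) := by
  obtain ⟨G, hG, ⟨K, hK⟩, rfl⟩ := H
  exact nishimori hφ hs ((hφ k).mul (hφ l)) hG hK

lemma hasDerivAt_gm_update [DecidableEq κ] (hφ : ∀ k, BddObs μ (fun x => φ x k)) (s : κ → ℝ)
    (k l : κ) (x : E) (g : κ → ℝ) :
    HasDerivAt (fun r => gm μ φ k s (x, Function.update g l r))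
      (√(s l) * gcov μ φ k l s (x, g)) (g l) :=
  hasDerivAt_gav_update hφ (hφ k) s l x g

lemma hasDerivAt_gcov_update [DecidableEq κ] (hφ : ∀ k, BddObs μ (fun x => φ x k)) (s : κ → ℝ)
    (k l : κ) (x : E) (g : κ → ℝ) :
    HasDerivAt (fun r => gcov μ φ k l s (x, Function.update g l r))
      (√(s l) * (gmmm μ φ k l s (x, g) - gm μ φ k s (x, g) * gmm μ φ l l s (x, g)
        - 2 * (gm μ φ l s (x, g) * gcov μ φ k l s (x, g)))) (g l) := by
  have h1 := hasDerivAt_gav_update hφ ((hφ k).mul (hφ l)) s l x g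
  have h2 := (hasDerivAt_gm_update hφ s k l x g).mul (hasDerivAt_gm_update hφ s l l x g)
  refine (h1.sub h2).congr_deriv ?_
  simp only [Function.update_eq_self, mul_assoc]
  simp only [gcov, gmm, gmmm, gm]
  ring

/-- `𝔼[g_k ⟨φ_k⟩] = √s_k 𝔼[⟨φ_k²⟩ - ⟨φ_k⟩²]`. -/
lemma integral_coord_mul_gm (hφ : ∀ k, BddObs μ (fun x => φ x k)) (s : κ → ℝ) (k : κ) :
    ∫ ω, ω.2 k * gm μ φ k s ω ∂(plantedLaw μ κ)
      = √(s k) * ∫ ω, gcov μ φ k k s ω ∂(plantedLaw μ κ) := by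
  classical
  rw [← integral_const_mul]
  exact BddFam.integral_coord_mul (bddFam_gm (fun _ : Unit => s) hφ k)
    ((bddFam_gcov (fun _ : Unit => s) hφ k k).const_mul √(s k)) () k
    (fun x g => hasDerivAt_gm_update hφ s k k x g)

lemma integral_feature_mul_gm (hφ : ∀ k, BddObs μ (fun x => φ x k)) (hs : ∀ k, 0 ≤ s k) (k : κ) :
    ∫ ω, φ ω.1 k * gm μ φ k s ω ∂(plantedLaw μ κ) = ∫ ω, gm μ φ k s ω ^ 2 ∂(plantedLaw μ κ) := by
  simp only [pow_two]
  exact nishimori_gm hφ hs k (obsFun_gm hφ k)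

/-- The contribution of the channel `k` to the mean derivative: integration by parts turns the noise
term into half a Gibbs variance, and the Nishimori identity turns `𝔼[φ_k(x̄) ⟨φ_k⟩]` into
`𝔼⟨φ_k⟩²`. -/
lemma integral_dlogZ_term (hφ : ∀ k, BddObs μ (fun x => φ x k))
    (hσ : ∀ k, 0 ≤ σ k) (ha : ∀ k, 0 ≤ a k) {θ : ℝ} (hθ : 0 < θ) (k : κ) :
    sqrtSlope σ a θ k * ∫ ω, ω.2 k * gm μ φ k (strength σ a θ) ω ∂(plantedLaw μ κ)
      + ∫ ω, a k * (φ ω.1 k * gm μ φ k (strength σ a θ) ω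
          - gmm μ φ k k (strength σ a θ) ω / 2) ∂(plantedLaw μ κ)
      = 1 / 2 * (a k * ∫ ω, gm μ φ k (strength σ a θ) ω ^ 2 ∂(plantedLaw μ κ)) := by
  have hs := strength_nonneg hσ ha hθ.le
  set s := strength σ a θ
  have b1 := (bddFam_gm (fun _ : Unit => s) hφ k)
  have b2 := (bddFam_gmm (fun _ : Unit => s) hφ k k)
  have b3 : BddFam μ (fun (_ : Unit) (ω : E × (κ → ℝ)) => φ ω.1 k) := BddFam.signal (hφ k)
  have e1 : ∫ ω, gcov μ φ k k s ω ∂(plantedLaw μ κ) = ∫ ω, gmm μ φ k k s ω ∂(plantedLaw μ κ)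
      - ∫ ω, gm μ φ k s ω ^ 2 ∂(plantedLaw μ κ) := by
    simp only [gcov, pow_two]
    exact integral_sub (b2.integrable ()) ((b1.mul b1).integrable ())
  rw [integral_const_mul, integral_sub ((b3.mul b1).integrable ()) ((b2.integrable ()).div_const 2),
    integral_feature_mul_gm hφ hs, integral_div, integral_coord_mul_gm hφ, ← mul_assoc,
    sqrtSlope_mul_sqrt hσ ha hθ, e1]
  ring

/-- For a positive parameter, the derivative of the averaged log-partition function is half the
mean overlap `∑ k, a_k 𝔼⟨φ_k⟩²`. -/
lemma hasDerivAt_integral_logZ (hφ : ∀ k, BddObs μ (fun x => φ x k))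
    (hσ : ∀ k, 0 ≤ σ k) (ha : ∀ k, 0 ≤ a k) {θ : ℝ} (hθ : 0 < θ) :
    HasDerivAt (fun θ => ∫ ω, logZ μ φ (strength σ a θ) ω ∂(plantedLaw μ κ))
      (1 / 2 * ∑ k, a k * ∫ ω, gm μ φ k (strength σ a θ) ω ^ 2 ∂(plantedLaw μ κ)) θ := by
  have h := hasDerivAt_integral_planted (μ := μ) hσ ha hθ
    (F := fun θ => logZ μ φ (strength σ a θ))
    (α := fun k θ => gm μ φ k (strength σ a θ))
    (β := fun k θ ω => a k * (φ ω.1 k * gm μ φ k (strength σ a θ) ω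
        - gmm μ φ k k (strength σ a θ) ω / 2))
    (fun θ => measurable_logZ hφ _) (integrable_logZ hφ _) (fun k => bddFam_gm _ hφ k)
    (fun k => (((BddFam.signal (hφ k)).mul (bddFam_gm _ hφ k)).sub
      ((bddFam_gmm _ hφ k k).div_const 2)).const_mul (a k))
    (fun ω θ hθ => hasDerivAt_logZ hφ hσ ha hθ ω)
  refine h.congr_deriv ?_
  rw [Finset.mul_sum]
  exact Finset.sum_congr rfl fun k _ => integral_dlogZ_term hφ hσ ha hθ k

lemma integral_dlogZ (hφ : ∀ k, BddObs μ (fun x => φ x k))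
    (hσ : ∀ k, 0 ≤ σ k) (ha : ∀ k, 0 ≤ a k) {θ : ℝ} (hθ : 0 < θ) :
    ∫ ω, dlogZ μ φ σ a θ ω ∂(plantedLaw μ κ)
      = 1 / 2 * ∑ k, a k * ∫ ω, gm μ φ k (strength σ a θ) ω ^ 2 ∂(plantedLaw μ κ) := by
  have b1 := fun k => bddFam_gm (fun _ : Unit => strength σ a θ) hφ k
  have b2 : ∀ k, BddFam μ (fun (_ : Unit) ω => a k * (φ ω.1 k * gm μ φ k (strength σ a θ) ω
        - gmm μ φ k k (strength σ a θ) ω / 2)) := fun k =>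
    (((BddFam.signal (hφ k)).mul (b1 k)).sub 
      ((bddFam_gmm (fun _ : Unit => strength σ a θ) hφ k k).div_const 2)).const_mul (a k)
  have i1 := fun k => ((b1 k).integrable_coord_mul () k).const_mul (sqrtSlope σ a θ k)
  have i2 : ∀ k, Integrable (fun ω => sqrtSlope σ a θ k * (ω.2 k * gm μ φ k (strength σ a θ) ω)
      + a k * (φ ω.1 k * gm μ φ k (strength σ a θ) ω - gmm μ φ k k (strength σ a θ) ω / 2))
      (plantedLaw μ κ) := fun k => (i1 k).add ((b2 k).integrable ())
  simp only [dlogZ]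
  rw [integral_finsetSum _ fun k _ => i2 k, Finset.mul_sum]
  refine Finset.sum_congr rfl fun k _ => ?_
  rw [integral_add (i1 k) ((b2 k).integrable ()), integral_const_mul]
  exact integral_dlogZ_term hφ hσ ha hθ k

/-- At the boundary point `θ = 0`, where `√θ` is not differentiable, the one-sided derivative is the
limit of the derivatives at positive points. -/
lemma hasDerivWithinAt_integral_logZ (hφ : ∀ k, BddObs μ (fun x => φ x k))
    (hσ : ∀ k, 0 ≤ σ k) (ha : ∀ k, 0 ≤ a k) {θ : ℝ} (hθ : 0 ≤ θ) :
    HasDerivWithinAt (fun θ => ∫ ω, logZ μ φ (strength σ a θ) ω ∂(plantedLaw μ κ))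
      (1 / 2 * ∑ k, a k * ∫ ω, gm μ φ k (strength σ a θ) ω ^ 2 ∂(plantedLaw μ κ)) (Ici 0) θ := by
  rcases hθ.eq_or_lt with rfl | hθ
  · have hd := fun θ (hθ : θ ∈ Ioi (0 : ℝ)) =>
      hasDerivAt_integral_logZ (μ := μ) hφ hσ ha (mem_Ioi.1 hθ)
    refine hasDerivWithinAt_Ici_of_tendsto_deriv (s := Ioi 0)
      (fun θ hθ => (hd θ hθ).differentiableAt.differentiableWithinAt)
      (continuous_integral_logZ hφ).continuousWithinAt self_mem_nhdsWithin ?_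
    have hc : Continuous fun θ =>
        1 / 2 * ∑ k, a k * ∫ ω, gm μ φ k (strength σ a θ) ω ^ 2 ∂(plantedLaw μ κ) :=
      continuous_const.mul (continuous_finsetSum _ fun k _ =>
        continuous_const.mul (continuous_integral_gm_sq hφ k))
    refine ((hc.tendsto 0).mono_left nhdsWithin_le_nhds).congr' ?_
    filter_upwards [self_mem_nhdsWithin] with θ hθ using (hd θ hθ).deriv.symm
  · exact (hasDerivAt_integral_logZ hφ hσ ha hθ).hasDerivWithinAt

/-- `𝔼⟨φ_k⟩²` is nondecreasing along the line, with derivative `∑ l, a_l 𝔼[C_kl²]` where `C` is the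
Gibbs covariance. -/
lemma hasDerivAt_integral_gm_sq (hφ : ∀ k, BddObs μ (fun x => φ x k))
    (hσ : ∀ k, 0 ≤ σ k) (ha : ∀ k, 0 ≤ a k) {θ : ℝ} (hθ : 0 < θ) (k : κ) :
    HasDerivAt (fun θ => ∫ ω, gm μ φ k (strength σ a θ) ω ^ 2 ∂(plantedLaw μ κ))
      (∑ l, a l * ∫ ω, gcov μ φ k l (strength σ a θ) ω ^ 2 ∂(plantedLaw μ κ)) θ := by
  classical
  have hfeat : ∀ {ι : Type} (k : κ), BddFam μ (fun (_ : ι) (ω : E × (κ → ℝ)) => φ ω.1 k) :=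
    fun k => BddFam.signal (hφ k)
  have hβ : ∀ {ι : Type} (t : ι → κ → ℝ) (l : κ), BddFam μ (fun i ω => gmmm μ φ k l (t i) ω
      - gm μ φ k (t i) ω * gmm μ φ l l (t i) ω) := fun t l =>
    (bddFam_gmmm t hφ k l).sub ((bddFam_gm t hφ k).mul (bddFam_gmm t hφ l l))
  have h := hasDerivAt_integral_planted (μ := μ) hσ ha hθ
    (F := fun θ ω => φ ω.1 k * gm μ φ k (strength σ a θ) ω)
    (α := fun l θ ω => φ ω.1 k * gcov μ φ k l (strength σ a θ) ω)
    (β := fun l θ ω => φ ω.1 k * (a l * (φ ω.1 l * gcov μ φ k l (strength σ a θ) ω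
          - (gmmm μ φ k l (strength σ a θ) ω
            - gm μ φ k (strength σ a θ) ω * gmm μ φ l l (strength σ a θ) ω) / 2)))
    (((hfeat k).mul (bddFam_gm _ hφ k)).meas) (((hfeat k).mul (bddFam_gm _ hφ k)).integrable θ)
    (fun l => (hfeat k).mul (bddFam_gcov _ hφ k l))
    (fun l => (hfeat k).mul ((((hfeat l).mul (bddFam_gcov _ hφ k l)).sub
      ((hβ _ l).div_const 2)).const_mul (a l)))
    (fun ω θ hθ => by
      refine ((hasDerivAt_gm hφ hσ ha hθ ω k).const_mul (φ ω.1 k)).congr_deriv ?_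
      rw [Finset.mul_sum]
      exact Finset.sum_congr rfl fun l _ => by ring)
  -- Only `φ_k(x̄) ⟨φ_k⟩` has a simple derivative under the expectation, and for `θ < 0` its mean
  -- need not agree with that of `⟨φ_k⟩²`.
  have heq : (fun θ => ∫ ω, gm μ φ k (strength σ a θ) ω ^ 2 ∂(plantedLaw μ κ)) =ᶠ[𝓝 θ]
      fun θ => ∫ ω, φ ω.1 k * gm μ φ k (strength σ a θ) ω ∂(plantedLaw μ κ) := by
    filter_upwards [lt_mem_nhds hθ] with θ' hθ'
    exact (integral_feature_mul_gm hφ (strength_nonneg hσ ha hθ'.le) k).symm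
  refine (h.congr_of_eventuallyEq heq).congr_deriv ?_
  refine Finset.sum_congr rfl fun l _ => ?_
  have hs := strength_nonneg hσ ha hθ.le
  have hq := sqrtSlope_mul_sqrt hσ ha hθ l
  set s := strength σ a θ
  have c1 : BddFam μ (fun _ : Unit => gcov μ φ k l s) := bddFam_gcov (fun _ => s) hφ k l
  have c2 : BddFam μ (fun _ : Unit => gm μ φ l s) := bddFam_gm (fun _ => s) hφ l
  have c3 := hβ (fun _ : Unit => s) l
  have c4 : BddFam μ (fun (_ : Unit) ω => gmmm μ φ k l s ω - gm μ φ k s ω * gmm μ φ l l s ω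
      - 2 * (gm μ φ l s ω * gcov μ φ k l s ω)) := c3.sub ((c2.mul c1).const_mul 2)
  have c7 : BddFam μ (fun (_ : Unit) ω => φ ω.1 k * (a l * (φ ω.1 l * gcov μ φ k l s ω
      - (gmmm μ φ k l s ω - gm μ φ k s ω * gmm μ φ l l s ω) / 2))) :=
    (hfeat k).mul ((((hfeat l).mul c1).sub (c3.div_const 2)).const_mul (a l))
  have ibp : ∫ ω, ω.2 l * (φ ω.1 k * gcov μ φ k l s ω) ∂(plantedLaw μ κ)
      = √(s l) * ∫ ω, φ ω.1 k * (gmmm μ φ k l s ω - gm μ φ k s ω * gmm μ φ l l s ω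
        - 2 * (gm μ φ l s ω * gcov μ φ k l s ω)) ∂(plantedLaw μ κ) := by
    rw [← integral_const_mul]
    refine BddFam.integral_coord_mul ((hfeat k).mul c1)
      (((hfeat k).mul c4).const_mul √(s l)) () l fun x g => ?_
    refine ((hasDerivAt_gcov_update hφ s k l x g).const_mul (φ x k)).congr_deriv ?_
    ring
  have N1 := nishimori_gmm hφ hs k l (obsFun_gcov (μ := μ) hφ k l)
  have N2 := nishimori_gm hφ hs k ((obsFun_gm (μ := μ) hφ l).mul (obsFun_gcov hφ k l))
  rw [ibp, ← mul_assoc, hq, ← integral_const_mul,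
    ← integral_add (((hfeat k).mul c4).integrable () |>.const_mul _)
      (c7.integrable ())]
  have c5 : BddFam μ (fun (_ : Unit) ω => φ ω.1 k * φ ω.1 l * gcov μ φ k l s ω) :=
    ((hfeat k).mul (hfeat l)).mul c1
  have c6 : BddFam μ (fun (_ : Unit) ω => φ ω.1 k * (gm μ φ l s ω * gcov μ φ k l s ω)) :=
    (hfeat k).mul (c2.mul c1)
  calc _ = ∫ ω, a l * (φ ω.1 k * φ ω.1 l * gcov μ φ k l s ω
          - φ ω.1 k * (gm μ φ l s ω * gcov μ φ k l s ω)) ∂(plantedLaw μ κ) := by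
        congr 1; ext ω; ring
    _ = a l * (∫ ω, gmm μ φ k l s ω * gcov μ φ k l s ω ∂(plantedLaw μ κ)
          - ∫ ω, gm μ φ k s ω * (gm μ φ l s ω * gcov μ φ k l s ω) ∂(plantedLaw μ κ)) := by
        rw [integral_const_mul, integral_sub (c5.integrable ()) (c6.integrable ()), N1, N2]
    _ = _ := by
        rw [← integral_sub (((bddFam_gmm (fun _ : Unit => s) hφ k l).mul c1).integrable ())
          (((bddFam_gm (fun _ : Unit => s) hφ k).mul (c2.mul c1)).integrable ())]
        congr 2
        ext ω
        simp only [gcov]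
        ring

end Overlaps

/-! ### The variance of the overlap -/

section Variance

variable {E κ : Type*} [MeasurableSpace E] [Fintype κ] {μ : Measure E} {φ : E → κ → ℝ}
  {σ a s : κ → ℝ}

/-- The weighted double sum `∑ k l, a_k a_l T_kl`. -/
def dsum (a : κ → ℝ) (T : κ → κ → ℝ) : ℝ := ∑ k, ∑ l, a k * a l * T k l

lemma integral_dsum {T : κ → κ → E × (κ → ℝ) → ℝ}
    (hT : ∀ k l, Integrable (T k l) (plantedLaw μ κ)) (a : κ → ℝ) :
    Integrable (fun ω => dsum a fun k l => T k l ω) (plantedLaw μ κ) ∧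
    ∫ ω, dsum a (fun k l => T k l ω) ∂(plantedLaw μ κ)
      = dsum a fun k l => ∫ ω, T k l ω ∂(plantedLaw μ κ) := by
  have h1 : ∀ k l, Integrable (fun ω => a k * a l * T k l ω) (plantedLaw μ κ) :=
    fun k l => (hT k l).const_mul _
  have h2 : ∀ k, Integrable (fun ω => ∑ l, a k * a l * T k l ω) (plantedLaw μ κ) :=
    fun k => integrable_finsetSum _ fun l _ => h1 k l
  refine ⟨integrable_finsetSum _ fun k _ => h2 k, ?_⟩
  simp only [dsum]
  rw [integral_finsetSum _ fun k _ => h2 k]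
  refine Finset.sum_congr rfl fun k _ => ?_
  rw [integral_finsetSum _ fun l _ => h1 k l]
  exact Finset.sum_congr rfl fun l _ => integral_const_mul _ _

lemma dsum_gcov_sq_nonneg (ha : ∀ k, 0 ≤ a k) (s : κ → ℝ) (ω : E × (κ → ℝ)) :
    0 ≤ dsum a (fun k l => gcov μ φ k l s ω ^ 2) :=
  Finset.sum_nonneg fun k _ => Finset.sum_nonneg fun l _ =>
    mul_nonneg (mul_nonneg (ha k) (ha l)) (sq_nonneg _)

lemma dsum_expand (a s : κ → ℝ) (ω : E × (κ → ℝ)) :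
    dsum a (fun k l => gcov μ φ k l s ω ^ 2) = dsum a (fun k l => gmm μ φ k l s ω ^ 2)
      - 2 * dsum a (fun k l => gmm μ φ k l s ω * (gm μ φ k s ω * gm μ φ l s ω))
      + dsum a (fun k l => (gm μ φ k s ω * gm μ φ l s ω) * (gm μ φ k s ω * gm μ φ l s ω)) := by
  simp only [dsum, Finset.mul_sum, ← Finset.sum_sub_distrib, ← Finset.sum_add_distrib, gcov]
  exact Finset.sum_congr rfl fun k _ => Finset.sum_congr rfl fun l _ => by ring

variable [IsProbabilityMeasure μ]

/-- The comparison variable `∑ k, a_k (φ_k(x̄) ⟨φ_k⟩ - ⟨φ_k⟩² / 2)`, obtained from the derivative of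
the log-partition function by replacing the noise terms `g_k ⟨φ_k⟩` by their compensators
`√s_k (⟨φ_k²⟩ - ⟨φ_k⟩²)`. -/
noncomputable def proxy (μ : Measure E) (φ : E → κ → ℝ) (a s : κ → ℝ) (ω : E × (κ → ℝ)) : ℝ :=
  ∑ k, a k * (φ ω.1 k * gm μ φ k s ω - gm μ φ k s ω * gm μ φ k s ω / 2)

lemma bddFam_proxy_term (hφ : ∀ k, BddObs μ (fun x => φ x k)) (s : κ → ℝ) (k : κ) :
    BddFam μ (fun (_ : Unit) ω =>
      φ ω.1 k * gm μ φ k s ω - gm μ φ k s ω * gm μ φ k s ω / 2) :=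
  have b := bddFam_gm (fun _ : Unit => s) hφ k
  ((BddFam.signal (hφ k)).mul b).sub ((b.mul b).div_const 2)

lemma bddFam_proxy (hφ : ∀ k, BddObs μ (fun x => φ x k)) (a s : κ → ℝ) :
    BddFam μ (fun _ : Unit => proxy μ φ a s) :=
  BddFam.sum _ fun k => (bddFam_proxy_term hφ s k).const_mul (a k)

/-- Integration by parts against the proxy. Only the derivative of `⟨φ_k⟩` contributes. -/
lemma integral_coord_mul_gm_mul_proxy (hφ : ∀ k, BddObs μ (fun x => φ x k)) (hs : ∀ k, 0 ≤ s k)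
    (k : κ) :
    ∫ ω, ω.2 k * (gm μ φ k s ω * proxy μ φ a s ω) ∂(plantedLaw μ κ)
      = √(s k) * ∫ ω, gcov μ φ k k s ω * proxy μ φ a s ω ∂(plantedLaw μ κ) := by
  classical
  have hfeat : ∀ k : κ, BddFam μ (fun (_ : Unit) (ω : E × (κ → ℝ)) => φ ω.1 k) :=
    fun k => BddFam.signal (hφ k)
  have b1 := fun k => bddFam_gm (fun _ : Unit => s) hφ k
  have b2 := fun k l => bddFam_gcov (fun _ : Unit => s) hφ k l
  have bV := bddFam_proxy hφ a s
  have d1 : ∀ l, BddFam μ (fun (_ : Unit) ω => φ ω.1 l * (gm μ φ k s ω * gcov μ φ l k s ω)) :=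
    fun l => (hfeat l).mul ((b1 k).mul (b2 l k))
  have d2 : ∀ l, BddFam μ
      (fun (_ : Unit) ω => gm μ φ l s ω * (gm μ φ k s ω * gcov μ φ l k s ω)) :=
    fun l => (b1 l).mul ((b1 k).mul (b2 l k))
  have d3 : ∀ l, BddFam μ
      (fun (_ : Unit) ω => a l * (φ ω.1 l * (gm μ φ k s ω * gcov μ φ l k s ω)
        - gm μ φ l s ω * (gm μ φ k s ω * gcov μ φ l k s ω))) :=
    fun l => ((d1 l).sub (d2 l)).const_mul (a l)
  have d4 := BddFam.sum Finset.univ d3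
  have d5 := (b2 k k).mul bV
  -- The contribution of the gradient of the proxy vanishes by the Nishimori identity.
  have hzero : ∫ ω, ∑ l, a l * (φ ω.1 l * (gm μ φ k s ω * gcov μ φ l k s ω)
      - gm μ φ l s ω * (gm μ φ k s ω * gcov μ φ l k s ω)) ∂(plantedLaw μ κ) = 0 := by
    rw [integral_finsetSum _ fun l _ => (d3 l).integrable ()]
    refine Finset.sum_eq_zero fun l _ => ?_
    rw [integral_const_mul, integral_sub ((d1 l).integrable ()) ((d2 l).integrable ()),
      nishimori_gm hφ hs l ((obsFun_gm hφ k).mul (obsFun_gcov hφ l k)), sub_self, mul_zero]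
  have ibp := BddFam.integral_coord_mul ((b1 k).mul bV) ((d5.add d4).const_mul √(s k)) () k
    (fun x g => by
      have hV : HasDerivAt (fun r => proxy μ φ a s (x, Function.update g k r))
          (∑ l, a l * (√(s k) * (φ x l * gcov μ φ l k s (x, g)
            - gm μ φ l s (x, g) * gcov μ φ l k s (x, g)))) (g k) := by
        refine HasDerivAt.fun_sum fun l _ => ?_
        have h := hasDerivAt_gm_update hφ s l k x g
        refine (((h.const_mul (φ x l)).sub ((h.mul h).div_const 2)).const_mul (a l)).congr_deriv ?_
        simp only [Function.update_eq_self]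
        ring
      refine ((hasDerivAt_gm_update hφ s k k x g).mul hV).congr_deriv ?_
      simp only [Function.update_eq_self, mul_add, Finset.mul_sum]
      congr 1
      · ring
      · exact Finset.sum_congr rfl fun l _ => by ring)
  rw [ibp, integral_const_mul, integral_add (d5.integrable ()) (d4.integrable ()), hzero, add_zero]

lemma memLp_dlogZ (hφ : ∀ k, BddObs μ (fun x => φ x k)) (σ a : κ → ℝ) (θ : ℝ) :
    MemLp (dlogZ μ φ σ a θ) 2 (plantedLaw μ κ) := by
  set s := strength σ a θ with hs
  have b1 := fun k => bddFam_gm (fun _ : Unit => s) hφ k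
  have b2 : ∀ k, BddFam μ (fun (_ : Unit) ω =>
      a k * (φ ω.1 k * gm μ φ k s ω - gmm μ φ k k s ω / 2)) := fun k =>
    (((BddFam.signal (hφ k)).mul (b1 k)).sub
      ((bddFam_gmm (fun _ : Unit => s) hφ k k).div_const 2)).const_mul (a k)
  exact memLp_finsetSum _ fun k _ =>
    (((b1 k).memLp_coord_mul () k).const_mul _).add ((b2 k).memLp ())

/-- The difference between the derivative of the log-partition function and its proxy is orthogonal
to the proxy. -/
lemma integral_dlogZ_mul_proxy (hφ : ∀ k, BddObs μ (fun x => φ x k))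
    (hσ : ∀ k, 0 ≤ σ k) (ha : ∀ k, 0 ≤ a k) {θ : ℝ} (hθ : 0 < θ) :
    ∫ ω, dlogZ μ φ σ a θ ω * proxy μ φ a (strength σ a θ) ω ∂(plantedLaw μ κ)
      = ∫ ω, proxy μ φ a (strength σ a θ) ω * proxy μ φ a (strength σ a θ) ω
          ∂(plantedLaw μ κ) := by
  have hs := strength_nonneg hσ ha hθ.le
  have hq := sqrtSlope_mul_sqrt hσ ha hθ
  simp only [dlogZ]
  set s := strength σ a θ with hsdef
  set V := proxy μ φ a s with hV
  have bV : BddFam μ (fun _ : Unit => V) := bddFam_proxy hφ a s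
  have b1 := fun k => bddFam_gm (fun _ : Unit => s) hφ k
  have b2 := fun k => bddFam_gcov (fun _ : Unit => s) hφ k k
  have b3 : ∀ k, BddFam μ (fun (_ : Unit) ω =>
      (φ ω.1 k * gm μ φ k s ω - gmm μ φ k k s ω / 2) * V ω) := fun k =>
    (((BddFam.signal (hφ k)).mul (b1 k)).sub
      ((bddFam_gmm (fun _ : Unit => s) hφ k k).div_const 2)).mul bV
  have b4 : ∀ k, BddFam μ (fun (_ : Unit) ω =>
      (φ ω.1 k * gm μ φ k s ω - gm μ φ k s ω * gm μ φ k s ω / 2) * V ω) := fun k =>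
    (bddFam_proxy_term hφ s k).mul bV
  have i1 : ∀ k, Integrable (fun ω => ω.2 k * (gm μ φ k s ω * V ω)) (plantedLaw μ κ) :=
    fun k => ((b1 k).mul bV).integrable_coord_mul () k
  have i2 : ∀ k, Integrable (fun ω => sqrtSlope σ a θ k * (ω.2 k * (gm μ φ k s ω * V ω))
      + a k * ((φ ω.1 k * gm μ φ k s ω - gmm μ φ k k s ω / 2) * V ω)) (plantedLaw μ κ) :=
    fun k => ((i1 k).const_mul _).add (((b3 k).integrable ()).const_mul (a k))
  have e1 : ∀ ω, (∑ k, (sqrtSlope σ a θ k * (ω.2 k * gm μ φ k s ω)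
      + a k * (φ ω.1 k * gm μ φ k s ω - gmm μ φ k k s ω / 2))) * V ω
      = ∑ k, (sqrtSlope σ a θ k * (ω.2 k * (gm μ φ k s ω * V ω))
      + a k * ((φ ω.1 k * gm μ φ k s ω - gmm μ φ k k s ω / 2) * V ω)) := fun ω => by
    rw [Finset.sum_mul]
    exact Finset.sum_congr rfl fun k _ => by ring
  have e2 : ∀ ω, V ω * V ω = ∑ k, a k *
      ((φ ω.1 k * gm μ φ k s ω - gm μ φ k s ω * gm μ φ k s ω / 2) * V ω) := fun ω => by
    have e : V ω = ∑ k, a k *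
        (φ ω.1 k * gm μ φ k s ω - gm μ φ k s ω * gm μ φ k s ω / 2) := rfl
    nth_rewrite 1 [e]
    rw [Finset.sum_mul]
    exact Finset.sum_congr rfl fun k _ => by ring
  simp only [e1, e2]
  rw [integral_finsetSum _ fun k _ => i2 k,
    integral_finsetSum _ fun k _ => ((b4 k).integrable ()).const_mul (a k)]
  refine Finset.sum_congr rfl fun k _ => ?_
  rw [integral_add ((i1 k).const_mul _) (((b3 k).integrable ()).const_mul (a k)),
    integral_const_mul, integral_coord_mul_gm_mul_proxy hφ hs k, ← mul_assoc, hq k,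
    ← integral_const_mul,
    ← integral_add ((((b2 k).mul bV).integrable ()).const_mul _)
      (((b3 k).integrable ()).const_mul (a k))]
  congr 1
  ext ω
  simp only [gcov]
  ring

/-- The Nishimori identity removes the signal from the second moment of the proxy: the product of
two signal features becomes `⟨φ_k φ_l⟩`, a single one becomes `⟨φ_k⟩`. -/
lemma integral_proxy_sq_term (hφ : ∀ k, BddObs μ (fun x => φ x k)) (hs : ∀ k, 0 ≤ s k) (k l : κ) :
    ∫ ω, (φ ω.1 k * gm μ φ k s ω - gm μ φ k s ω * gm μ φ k s ω / 2)
        * (φ ω.1 l * gm μ φ l s ω - gm μ φ l s ω * gm μ φ l s ω / 2) ∂(plantedLaw μ κ)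
      = ∫ ω, (gmm μ φ k l s ω * (gm μ φ k s ω * gm μ φ l s ω)
        - 3 / 4 * ((gm μ φ k s ω * gm μ φ l s ω) * (gm μ φ k s ω * gm μ φ l s ω)))
          ∂(plantedLaw μ κ) := by
  have hfeat : ∀ k : κ, BddFam μ (fun (_ : Unit) (ω : E × (κ → ℝ)) => φ ω.1 k) :=
    fun k => BddFam.signal (hφ k)
  have b := fun k => bddFam_gm (fun _ : Unit => s) hφ k
  have o := fun k => obsFun_gm (s := s) (μ := μ) hφ k
  have c1 : Integrable (fun ω => φ ω.1 k * φ ω.1 l * (gm μ φ k s ω * gm μ φ l s ω))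
    (plantedLaw μ κ) := (((hfeat k).mul (hfeat l)).mul ((b k).mul (b l))).integrable ()
  have c2 : Integrable (fun ω => φ ω.1 k * (gm μ φ k s ω * (gm μ φ l s ω * gm μ φ l s ω)))
    (plantedLaw μ κ) := ((hfeat k).mul ((b k).mul ((b l).mul (b l)))).integrable ()
  have c3 : Integrable (fun ω => φ ω.1 l * (gm μ φ l s ω * (gm μ φ k s ω * gm μ φ k s ω)))
    (plantedLaw μ κ) := ((hfeat l).mul ((b l).mul ((b k).mul (b k)))).integrable ()
  have c4 : Integrable (fun ω => (gm μ φ k s ω * gm μ φ l s ω) * (gm μ φ k s ω * gm μ φ l s ω))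
    (plantedLaw μ κ) := (((b k).mul (b l)).mul ((b k).mul (b l))).integrable ()
  have c5 : Integrable (fun ω => gmm μ φ k l s ω * (gm μ φ k s ω * gm μ φ l s ω))
    (plantedLaw μ κ) :=
    ((bddFam_gmm (fun _ : Unit => s) hφ k l).mul ((b k).mul (b l))).integrable ()
  have n1 := nishimori_gmm hφ hs k l ((o k).mul (o l))
  have n2 : ∫ ω, φ ω.1 k * (gm μ φ k s ω * (gm μ φ l s ω * gm μ φ l s ω)) ∂(plantedLaw μ κ)
      = ∫ ω, (gm μ φ k s ω * gm μ φ l s ω) * (gm μ φ k s ω * gm μ φ l s ω) ∂(plantedLaw μ κ) := by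
    rw [nishimori_gm hφ hs k ((o k).mul ((o l).mul (o l)))]
    congr 1; ext ω; ring
  have n3 : ∫ ω, φ ω.1 l * (gm μ φ l s ω * (gm μ φ k s ω * gm μ φ k s ω)) ∂(plantedLaw μ κ)
      = ∫ ω, (gm μ φ k s ω * gm μ φ l s ω) * (gm μ φ k s ω * gm μ φ l s ω) ∂(plantedLaw μ κ) := by
    rw [nishimori_gm hφ hs l ((o l).mul ((o k).mul (o k)))]
    congr 1; ext ω; ring
  rw [integral_sub c5 (c4.const_mul _), integral_const_mul]
  have d1 : Integrable (fun ω => φ ω.1 k * φ ω.1 l * (gm μ φ k s ω * gm μ φ l s ω)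
      - 1 / 2 * (φ ω.1 k * (gm μ φ k s ω * (gm μ φ l s ω * gm μ φ l s ω)))) (plantedLaw μ κ) :=
    c1.sub (c2.const_mul _)
  have d2 : Integrable (fun ω => φ ω.1 k * φ ω.1 l * (gm μ φ k s ω * gm μ φ l s ω)
      - 1 / 2 * (φ ω.1 k * (gm μ φ k s ω * (gm μ φ l s ω * gm μ φ l s ω)))
      - 1 / 2 * (φ ω.1 l * (gm μ φ l s ω * (gm μ φ k s ω * gm μ φ k s ω)))) (plantedLaw μ κ) :=
    d1.sub (c3.const_mul _)
  calc _ = ∫ ω, (φ ω.1 k * φ ω.1 l * (gm μ φ k s ω * gm μ φ l s ω)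
          - 1 / 2 * (φ ω.1 k * (gm μ φ k s ω * (gm μ φ l s ω * gm μ φ l s ω)))
          - 1 / 2 * (φ ω.1 l * (gm μ φ l s ω * (gm μ φ k s ω * gm μ φ k s ω)))
          + 1 / 4 * ((gm μ φ k s ω * gm μ φ l s ω) * (gm μ φ k s ω * gm μ φ l s ω)))
          ∂(plantedLaw μ κ) := by congr 1; ext ω; ring
    _ = _ := by
        rw [integral_add d2 (c4.const_mul _), integral_sub d1 (c3.const_mul _),
          integral_sub c1 (c2.const_mul _), integral_const_mul, integral_const_mul,
          integral_const_mul, n1, n2, n3]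
        ring

lemma integral_proxy_sq (hφ : ∀ k, BddObs μ (fun x => φ x k)) (hs : ∀ k, 0 ≤ s k) :
    ∫ ω, proxy μ φ a s ω * proxy μ φ a s ω ∂(plantedLaw μ κ)
      = ∫ ω, dsum a (fun k l => gmm μ φ k l s ω * (gm μ φ k s ω * gm μ φ l s ω)
        - 3 / 4 * ((gm μ φ k s ω * gm μ φ l s ω) * (gm μ φ k s ω * gm μ φ l s ω)))
          ∂(plantedLaw μ κ) := by
  have b := fun k => bddFam_gm (fun _ : Unit => s) hφ k
  have hI : ∀ k l, Integrable (fun ω => gmm μ φ k l s ω * (gm μ φ k s ω * gm μ φ l s ω)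
        - 3 / 4 * ((gm μ φ k s ω * gm μ φ l s ω) * (gm μ φ k s ω * gm μ φ l s ω)))
      (plantedLaw μ κ) := fun k l =>
    (((bddFam_gmm (fun _ : Unit => s) hφ k l).mul ((b k).mul (b l))).sub
      ((((b k).mul (b l)).mul ((b k).mul (b l))).const_mul _)).integrable ()
  rw [(integral_dsum hI a).2]
  simp only [← integral_proxy_sq_term hφ hs]
  rw [← (integral_dsum (fun k l =>
    ((bddFam_proxy_term hφ s k).mul (bddFam_proxy_term hφ s l)).integrable ()) a).2]
  congr 1
  ext ω
  rw [proxy, Finset.sum_mul_sum, dsum]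
  exact Finset.sum_congr rfl fun k _ => Finset.sum_congr rfl fun l _ => by ring

/-- Jensen's inequality for the Gibbs measure, applied to `∑ k, a_k ⟨φ_k⟩ φ_k`. -/
lemma dsum_gm_le (hφ : ∀ k, BddObs μ (fun x => φ x k)) (a s : κ → ℝ) (ω : E × (κ → ℝ)) :
    dsum a (fun k l => (gm μ φ k s ω * gm μ φ l s ω) * (gm μ φ k s ω * gm μ φ l s ω))
      ≤ dsum a (fun k l => gmm μ φ k l s ω * (gm μ φ k s ω * gm μ φ l s ω)) := by
  have hψ := bddObs_features hφ
  set b : κ → ℝ := fun k => a k * gm μ φ k s ω with hb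
  have h1 : ∀ k, BddObs μ (fun x => b k * φ x k) := fun k => (BddObs.const μ _).mul (hφ k)
  have hf : BddObs μ (fun x => ∑ k, b k * φ x k) := by
    choose K hK using fun k => (h1 k).bdd
    refine ⟨Finset.measurable_fun_sum _ fun k _ => (h1 k).meas, ∑ k, K k, ?_⟩
    filter_upwards [ae_all_iff.2 hK] with x hx
    exact (Finset.abs_sum_le_sum_abs _ _).trans (Finset.sum_le_sum fun k _ => hx k)
  have key := sq_gibbsAvg_le hψ hf (obs φ s ω)
  have e1 : gibbsAvg μ (features φ) (fun x => ∑ k, b k * φ x k) (obs φ s ω)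
      = ∑ k, b k * gm μ φ k s ω := by
    rw [gibbsAvg_sum hψ _ fun k _ => h1 k]
    exact Finset.sum_congr rfl fun k _ => gibbsAvg_const_mul _ _
  have e2 : gibbsAvg μ (features φ) (fun x => (∑ k, b k * φ x k) * ∑ k, b k * φ x k) (obs φ s ω)
      = ∑ k, ∑ l, b k * b l * gmm μ φ k l s ω := by
    have e3 : (fun x => (∑ k, b k * φ x k) * ∑ k, b k * φ x k)
        = fun x => ∑ p : κ × κ, (b p.1 * b p.2) * (φ x p.1 * φ x p.2) := by
      ext x
      rw [Finset.sum_mul_sum, Fintype.sum_prod_type]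
      exact Finset.sum_congr rfl fun k _ => Finset.sum_congr rfl fun l _ => by ring
    rw [e3, gibbsAvg_sum hψ _ fun p _ => (BddObs.const μ _).mul ((hφ p.1).mul (hφ p.2)),
      Fintype.sum_prod_type]
    exact Finset.sum_congr rfl fun k _ => Finset.sum_congr rfl fun l _ => gibbsAvg_const_mul _ _
  rw [e1, e2, pow_two, Finset.sum_mul_sum] at key
  refine (le_of_eq ?_).trans (key.trans (le_of_eq ?_)) <;>
    exact Finset.sum_congr rfl fun k _ => Finset.sum_congr rfl fun l _ => by
      simp only [hb]; ring

/-- The square of the mean overlap is at most the mean squared overlap. -/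
lemma sq_sum_integral_gm_sq_le (hφ : ∀ k, BddObs μ (fun x => φ x k)) (ha : ∀ k, 0 ≤ a k) :
    (∑ k, a k * ∫ ω, gm μ φ k s ω ^ 2 ∂(plantedLaw μ κ)) ^ 2
      ≤ dsum a fun k l => ∫ ω, gmm μ φ k l s ω ^ 2 ∂(plantedLaw μ κ) := by
  have b : ∀ k, BddFam μ (fun (_ : Unit) ω => gm μ φ k s ω ^ 2) := fun k => by
    simpa only [pow_two] using
      (bddFam_gm (fun _ : Unit => s) hφ k).mul (bddFam_gm (fun _ : Unit => s) hφ k)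
  have bS := BddFam.sum Finset.univ fun k => (b k).const_mul (a k)
  have hT : ∀ k l, Integrable (fun ω => gmm μ φ k l s ω ^ 2) (plantedLaw μ κ) := fun k l => by
    simpa only [pow_two] using ((bddFam_gmm (fun _ : Unit => s) hφ k l).mul
      (bddFam_gmm (fun _ : Unit => s) hφ k l)).integrable ()
  have h1 : ∑ k, a k * ∫ ω, gm μ φ k s ω ^ 2 ∂(plantedLaw μ κ)
      = ∫ ω, ∑ k, a k * gm μ φ k s ω ^ 2 ∂(plantedLaw μ κ) := by
    rw [integral_finsetSum _ fun k _ => ((b k).integrable ()).const_mul (a k)]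
    exact Finset.sum_congr rfl fun k _ => (integral_const_mul _ _).symm
  rw [h1, ← (integral_dsum hT a).2]
  refine (sq_integral_le (bS.integrable ()) ((bS.mul bS).integrable ())).trans
    (integral_mono ((bS.mul bS).integrable ()) (integral_dsum hT a).1 fun ω => ?_)
  have e : (∑ k, a k * gm μ φ k s ω ^ 2) * ∑ k, a k * gm μ φ k s ω ^ 2
      = dsum a fun k l => (gm μ φ k s ω * gm μ φ l s ω) * (gm μ φ k s ω * gm μ φ l s ω) := by
    rw [Finset.sum_mul_sum, dsum]
    exact Finset.sum_congr rfl fun k _ => Finset.sum_congr rfl fun l _ => by ring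
  simp only [e]
  have h2 := dsum_gm_le hφ a s ω
  have h3 := dsum_gcov_sq_nonneg (μ := μ) (φ := φ) ha s ω
  rw [dsum_expand] at h3
  linarith

/-- The second moment of the derivative of the log-partition function dominates that of its proxy,
which yields the upper bound on the variance of the overlap. -/
lemma variance_overlap_le (hφ : ∀ k, BddObs μ (fun x => φ x k))
    (hσ : ∀ k, 0 ≤ σ k) (ha : ∀ k, 0 ≤ a k) {θ : ℝ} (hθ : 0 < θ) :
    1 / 4 * (dsum a fun k l => ∫ ω, gmm μ φ k l (strength σ a θ) ω ^ 2 ∂(plantedLaw μ κ))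
      ≤ 1 / 2 * (dsum a fun k l => ∫ ω, gcov μ φ k l (strength σ a θ) ω ^ 2 ∂(plantedLaw μ κ))
        + ∫ ω, dlogZ μ φ σ a θ ω ^ 2 ∂(plantedLaw μ κ) := by
  have hs := strength_nonneg hσ ha hθ.le
  have hUV := integral_dlogZ_mul_proxy (μ := μ) hφ hσ ha hθ
  have hU := memLp_dlogZ (μ := μ) hφ σ a θ
  set s := strength σ a θ
  set U := dlogZ μ φ σ a θ
  have hV := (bddFam_proxy (μ := μ) hφ a s).memLp ()
  have b := fun k => bddFam_gm (fun _ : Unit => s) hφ k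
  have hT1 : ∀ k l, Integrable (fun ω => gmm μ φ k l s ω ^ 2) (plantedLaw μ κ) := fun k l => by
    simpa only [pow_two] using ((bddFam_gmm (fun _ : Unit => s) hφ k l).mul
      (bddFam_gmm (fun _ : Unit => s) hφ k l)).integrable ()
  have hT2 : ∀ k l, Integrable (fun ω => gcov μ φ k l s ω ^ 2) (plantedLaw μ κ) := fun k l => by
    simpa only [pow_two] using ((bddFam_gcov (fun _ : Unit => s) hφ k l).mul
      (bddFam_gcov (fun _ : Unit => s) hφ k l)).integrable ()
  have hT3 : ∀ k l, Integrable (fun ω => gmm μ φ k l s ω * (gm μ φ k s ω * gm μ φ l s ω)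
        - 3 / 4 * ((gm μ φ k s ω * gm μ φ l s ω) * (gm μ φ k s ω * gm μ φ l s ω)))
      (plantedLaw μ κ) := fun k l =>
    (((bddFam_gmm (fun _ : Unit => s) hφ k l).mul ((b k).mul (b l))).sub
      ((((b k).mul (b l)).mul ((b k).mul (b l))).const_mul _)).integrable ()
  -- The cross term equals the second moment of the proxy, so `𝔼[(U - V)²] = 𝔼[U²] - 𝔼[V²]`.
  have hVU : ∫ ω, proxy μ φ a s ω * proxy μ φ a s ω ∂(plantedLaw μ κ)
      ≤ ∫ ω, U ω ^ 2 ∂(plantedLaw μ κ) := by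
    have iU := hU.integrable_sq
    have iV : Integrable (fun ω => proxy μ φ a s ω * proxy μ φ a s ω) (plantedLaw μ κ) :=
      hV.integrable_mul hV
    have iUV : Integrable (fun ω => U ω * proxy μ φ a s ω) (plantedLaw μ κ) :=
      hU.integrable_mul hV
    have h0 : 0 ≤ ∫ ω, (U ω ^ 2 - 2 * (U ω * proxy μ φ a s ω)
        + proxy μ φ a s ω * proxy μ φ a s ω) ∂(plantedLaw μ κ) :=
      integral_nonneg fun ω => by
        simp only [Pi.zero_apply]
        nlinarith [sq_nonneg (U ω - proxy μ φ a s ω)]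
    rw [integral_add (f := fun ω => U ω ^ 2 - 2 * (U ω * proxy μ φ a s ω))
      (iU.sub (iUV.const_mul 2)) iV, integral_sub iU (iUV.const_mul 2), integral_const_mul,
      hUV] at h0
    linarith
  refine le_trans ?_ (add_le_add_right hVU _)
  rw [integral_proxy_sq hφ hs, ← (integral_dsum hT1 a).2, ← (integral_dsum hT2 a).2,
    ← integral_const_mul, ← integral_const_mul,
    ← integral_add ((integral_dsum hT2 a).1.const_mul _) (integral_dsum hT3 a).1]
  refine integral_mono ((integral_dsum hT1 a).1.const_mul _)
    (((integral_dsum hT2 a).1.const_mul _).add (integral_dsum hT3 a).1) fun ω => ?_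
  have h2 := dsum_gm_le hφ a s ω
  have h3 := dsum_gcov_sq_nonneg (μ := μ) (φ := φ) ha s ω
  have h4 := dsum_expand (μ := μ) (φ := φ) a s ω
  have h5 : dsum a (fun k l => gmm μ φ k l s ω * (gm μ φ k s ω * gm μ φ l s ω)
        - 3 / 4 * ((gm μ φ k s ω * gm μ φ l s ω) * (gm μ φ k s ω * gm μ φ l s ω)))
      = dsum a (fun k l => gmm μ φ k l s ω * (gm μ φ k s ω * gm μ φ l s ω))
        - 3 / 4 * dsum a (fun k l =>
          (gm μ φ k s ω * gm μ φ l s ω) * (gm μ φ k s ω * gm μ φ l s ω)) := by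
    simp only [dsum, Finset.mul_sum, ← Finset.sum_sub_distrib]
    exact Finset.sum_congr rfl fun k _ => Finset.sum_congr rfl fun l _ => by ring
  simp only [h5]
  linarith

end Variance

/-! ### The rank-one model as a planted Gaussian channel -/

section RankOneChannel

/-- The channels of the model of size `N`: the entries of the matrix and of the vector. -/
abbrev Channel (N : ℕ) : Type := (Fin N × Fin N) ⊕ Fin N

/-- The features `x_i x_j / √N` of the matrix channel and `x_i` of the vector channel. -/
noncomputable def rankOneFeatures (N : ℕ) (x : Fin N → ℝ) : Channel N → ℝ :=
  Sum.elim (fun p => x p.1 * x p.2 / √N) x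

/-- The signal strength is `t` on the matrix channel and `h` on the vector channel. -/
def rankOneStrength (N : ℕ) (t h : ℝ) : Channel N → ℝ := Sum.elim (fun _ => t) fun _ => h

/-- The weights of the matrix channel. -/
def matrixWeight (N : ℕ) : Channel N → ℝ := Sum.elim (fun _ => 1) fun _ => 0

/-- The weights of the vector channel. -/
def vectorWeight (N : ℕ) : Channel N → ℝ := Sum.elim (fun _ => 0) fun _ => 1

lemma matrixWeight_nonneg (N : ℕ) (k : Channel N) : 0 ≤ matrixWeight N k := by
  cases k <;> simp [matrixWeight]

lemma vectorWeight_nonneg (N : ℕ) (k : Channel N) : 0 ≤ vectorWeight N k := by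
  cases k <;> simp [vectorWeight]

lemma rankOneStrength_nonneg (N : ℕ) {t h : ℝ} (ht : 0 ≤ t) (hh : 0 ≤ h) (k : Channel N) :
    0 ≤ rankOneStrength N t h k := by
  cases k <;> simpa [rankOneStrength]

lemma strength_matrixWeight (N : ℕ) (h t : ℝ) :
    strength (rankOneStrength N 0 h) (matrixWeight N) t = rankOneStrength N t h := by
  ext k
  cases k <;> simp [strength, rankOneStrength, matrixWeight]

lemma strength_vectorWeight (N : ℕ) (t h : ℝ) :
    strength (rankOneStrength N t 0) (vectorWeight N) h = rankOneStrength N t h := by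
  ext k
  cases k <;> simp [strength, rankOneStrength, vectorWeight]

/-- The two noises of the model are gathered into a single vector. -/
def disorderEquiv (N : ℕ) : Disorder N ≃ᵐ (Fin N → ℝ) × (Channel N → ℝ) :=
  (MeasurableEquiv.refl _).prodCongr (MeasurableEquiv.sumPiEquivProdPi fun _ => ℝ).symm

variable {P : Measure ℝ} {N : ℕ}

instance [IsProbabilityMeasure P] : IsProbabilityMeasure (priorN P N) := by
  unfold priorN; infer_instance

lemma measurePreserving_disorderEquiv [IsProbabilityMeasure P] :
    MeasurePreserving (disorderEquiv N) (disorderLaw P N) (plantedLaw (priorN P N) (Channel N)) :=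
  (MeasurePreserving.id (priorN P N)).prod
    (measurePreserving_sumPiEquivProdPi_symm fun _ : Channel N => gaussianReal 0 1)

lemma bddObs_rankOneFeatures [IsProbabilityMeasure P] (hP : ∃ R : ℝ, ∀ᵐ x ∂P, |x| ≤ R)
    (k : Channel N) : BddObs (priorN P N) fun x => rankOneFeatures N x k := by
  obtain ⟨R, hR⟩ := hP
  have h1 : ∀ i : Fin N, BddObs (priorN P N) fun x => x i := fun i =>
    ⟨measurable_pi_apply i, R,
      (measurePreserving_eval (fun _ : Fin N => P) i).quasiMeasurePreserving.ae hR⟩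
  cases k with
  | inl p =>
    have := (BddObs.const (priorN P N) (√N)⁻¹).mul ((h1 p.1).mul (h1 p.2))
    simpa only [rankOneFeatures, Sum.elim_inl, div_eq_inv_mul] using this
  | inr i => exact h1 i

/-- The Hamiltonian is linear in the sufficient statistics of the channel. -/
lemma hamiltonian_eq (t h : ℝ) (ω : Disorder N) (x : Fin N → ℝ) :
    hamiltonian N t h ω x = ∑ j, obs (rankOneFeatures N) (rankOneStrength N t h)
      (disorderEquiv N ω) j * features (rankOneFeatures N) x j := by
  obtain ⟨u, W, z⟩ := ω
  have hN : √(N : ℝ) * √N = N := Real.mul_self_sqrt (Nat.cast_nonneg N)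
  have e1 : ∀ p, (disorderEquiv N (u, W, z)).2 (.inl p) = W p := fun _ => rfl
  have e2 : ∀ i, (disorderEquiv N (u, W, z)).2 (.inr i) = z i := fun _ => rfl
  have e3 : (disorderEquiv N (u, W, z)).1 = u := rfl
  rw [sum_coeffs_mul_features]
  simp only [Fintype.sum_sum_type, obs, coeffs, Sum.elim_inl, Sum.elim_inr, rankOneFeatures,
    rankOneStrength, e1, e2, e3, hamiltonian]
  have hm : √(t / N) * (∑ i, ∑ j, W (i, j) * x i * x j) + t / N * (∑ i, x i * u i) ^ 2
      - t / (2 * N) * (∑ i, x i ^ 2) ^ 2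
      = ∑ p : Fin N × Fin N, ((√t * W p + t * (u p.1 * u p.2 / √N)) * (x p.1 * x p.2 / √N)
        + -(t / 2) * (x p.1 * x p.2 / √N * (x p.1 * x p.2 / √N))) := by
    rw [Real.sqrt_div' t (Nat.cast_nonneg N), pow_two (∑ i, x i * u i), pow_two (∑ i, x i ^ 2),
      Finset.sum_mul_sum, Finset.sum_mul_sum, Fintype.sum_prod_type]
    simp only [Finset.mul_sum, ← Finset.sum_sub_distrib, ← Finset.sum_add_distrib]
    refine Finset.sum_congr rfl fun i _ => Finset.sum_congr rfl fun j _ => ?_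
    rw [div_mul_div_comm, hN, add_mul, mul_assoc t, div_mul_div_comm, hN]
    ring
  have hv : √h * (∑ i, z i * x i) + h * (∑ i, x i * u i) - h / 2 * (∑ i, x i ^ 2)
      = ∑ i, ((√h * z i + h * u i) * x i + -(h / 2) * (x i * x i)) := by
    simp only [Finset.mul_sum, ← Finset.sum_sub_distrib, ← Finset.sum_add_distrib]
    exact Finset.sum_congr rfl fun i _ => by ring
  rw [← hm, ← hv]
  ring

lemma freeEnergy_eq (ω : Disorder N) (t h : ℝ) :
    freeEnergy P N ω t h = 1 / N * logZ (priorN P N) (rankOneFeatures N) (rankOneStrength N t h)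
      (disorderEquiv N ω) := by
  simp only [freeEnergy, logZ, expIntegral, one_mul, hamiltonian_eq]

/-- First moments of the matrix channel are second moments of the vector channel. -/
lemma gm_inl (i j : Fin N) (s : Channel N → ℝ) (ω : (Fin N → ℝ) × (Channel N → ℝ)) :
    gm (priorN P N) (rankOneFeatures N) (.inl (i, j)) s ω
      = (√N)⁻¹ * gmm (priorN P N) (rankOneFeatures N) (.inr i) (.inr j) s ω := by
  rw [gmm, gav, ← gibbsAvg_const_mul, gm, gav]
  congr 1
  ext x
  simp only [rankOneFeatures, Sum.elim_inl, Sum.elim_inr]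
  ring

variable [IsProbabilityMeasure P]

lemma integral_comp_disorderEquiv (F : (Fin N → ℝ) × (Channel N → ℝ) → ℝ) :
    ∫ ω, F (disorderEquiv N ω) ∂(disorderLaw P N)
      = ∫ ω, F ω ∂(plantedLaw (priorN P N) (Channel N)) :=
  measurePreserving_disorderEquiv.integral_comp' F

lemma avgFreeEnergy_eq (t h : ℝ) :
    avgFreeEnergy P N t h = 1 / N * ∫ ω, logZ (priorN P N) (rankOneFeatures N)
      (rankOneStrength N t h) ω ∂(plantedLaw (priorN P N) (Channel N)) := by
  simp only [avgFreeEnergy, freeEnergy_eq]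
  rw [integral_const_mul, integral_comp_disorderEquiv]

/-- The mean overlap `∑ i, 𝔼⟨x_i⟩² = 𝔼⟨x · x'⟩` of two replicas. -/
noncomputable def meanOverlap (P : Measure ℝ) (N : ℕ) (t h : ℝ) : ℝ :=
  ∑ k, vectorWeight N k * ∫ ω, gm (priorN P N) (rankOneFeatures N) k (rankOneStrength N t h) ω ^ 2
    ∂(plantedLaw (priorN P N) (Channel N))

/-- The mean squared overlap `∑ i j, 𝔼⟨x_i x_j⟩² = 𝔼⟨(x · x')²⟩` of two replicas. -/
noncomputable def meanSqOverlap (P : Measure ℝ) (N : ℕ) (t h : ℝ) : ℝ :=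
  dsum (vectorWeight N) fun k l =>
    ∫ ω, gmm (priorN P N) (rankOneFeatures N) k l (rankOneStrength N t h) ω ^ 2
      ∂(plantedLaw (priorN P N) (Channel N))

lemma hasDerivWithinAt_avgFreeEnergy_h (hP : ∃ R : ℝ, ∀ᵐ x ∂P, |x| ≤ R) {t h : ℝ} (ht : 0 ≤ t)
    (hh : 0 ≤ h) :
    HasDerivWithinAt (fun s => avgFreeEnergy P N t s) (1 / N * (1 / 2 * meanOverlap P N t h))
      (Ici 0) h := by
  have H := hasDerivWithinAt_integral_logZ (bddObs_rankOneFeatures hP (N := N))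
    (rankOneStrength_nonneg N ht le_rfl) (vectorWeight_nonneg N) hh
  simp only [strength_vectorWeight] at H
  simp only [avgFreeEnergy_eq]
  exact H.const_mul _

lemma hasDerivWithinAt_avgFreeEnergy_t (hP : ∃ R : ℝ, ∀ᵐ x ∂P, |x| ≤ R) {t h : ℝ} (ht : 0 ≤ t)
    (hh : 0 ≤ h) :
    HasDerivWithinAt (fun s => avgFreeEnergy P N s h)
      (1 / N * (1 / 2 * ((N : ℝ)⁻¹ * meanSqOverlap P N t h))) (Ici 0) t := by
  have H := hasDerivWithinAt_integral_logZ (bddObs_rankOneFeatures hP (N := N))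
    (rankOneStrength_nonneg N le_rfl hh) (matrixWeight_nonneg N) ht
  simp only [strength_matrixWeight] at H
  simp only [avgFreeEnergy_eq]
  refine (H.const_mul (1 / (N : ℝ))).congr_deriv ?_
  congr 2
  have hN : ((√(N : ℝ))⁻¹) ^ 2 = (N : ℝ)⁻¹ := by
    rw [inv_pow, Real.sq_sqrt (Nat.cast_nonneg N)]
  simp only [meanSqOverlap, dsum, Fintype.sum_sum_type, matrixWeight, vectorWeight, Sum.elim_inl,
    Sum.elim_inr, zero_mul, mul_zero, one_mul, Finset.sum_const_zero, add_zero, zero_add,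
    Fintype.sum_prod_type, gm_inl, mul_pow, hN, integral_const_mul, Finset.mul_sum]

lemma partialH_avgFreeEnergy (hP : ∃ R : ℝ, ∀ᵐ x ∂P, |x| ≤ R) {t h : ℝ} (ht : 0 ≤ t)
    (hh : 0 ≤ h) :
    partialH (avgFreeEnergy P N) t h = 1 / N * (1 / 2 * meanOverlap P N t h) :=
  (hasDerivWithinAt_avgFreeEnergy_h hP ht hh).derivWithin (uniqueDiffOn_Ici 0 h hh)

lemma partialT_avgFreeEnergy (hP : ∃ R : ℝ, ∀ᵐ x ∂P, |x| ≤ R) {t h : ℝ} (ht : 0 ≤ t)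
    (hh : 0 ≤ h) :
    partialT (avgFreeEnergy P N) t h = 1 / N * (1 / 2 * ((N : ℝ)⁻¹ * meanSqOverlap P N t h)) :=
  (hasDerivWithinAt_avgFreeEnergy_t hP ht hh).derivWithin (uniqueDiffOn_Ici 0 t ht)

lemma hasDerivAt_partialH_avgFreeEnergy (hP : ∃ R : ℝ, ∀ᵐ x ∂P, |x| ≤ R) {t h : ℝ} (ht : 0 ≤ t)
    (hh : 0 < h) :
    HasDerivAt (fun s => partialH (avgFreeEnergy P N) t s)
      (1 / N * (1 / 2 * dsum (vectorWeight N) fun k l =>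
        ∫ ω, gcov (priorN P N) (rankOneFeatures N) k l (rankOneStrength N t h) ω ^ 2
          ∂(plantedLaw (priorN P N) (Channel N)))) h := by
  have H : HasDerivAt (fun s => meanOverlap P N t s) (∑ k, vectorWeight N k *
      ∑ l, vectorWeight N l * ∫ ω, gcov (priorN P N) (rankOneFeatures N) k l
        (rankOneStrength N t h) ω ^ 2 ∂(plantedLaw (priorN P N) (Channel N))) h := by
    refine HasDerivAt.fun_sum fun k _ => ?_
    have H1 := hasDerivAt_integral_gm_sq (bddObs_rankOneFeatures hP (N := N))
      (rankOneStrength_nonneg N ht le_rfl) (vectorWeight_nonneg N) hh k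
    simp only [strength_vectorWeight] at H1
    exact H1.const_mul _
  have heq : (fun s => partialH (avgFreeEnergy P N) t s) =ᶠ[𝓝 h]
      fun s => 1 / (N : ℝ) * (1 / 2 * meanOverlap P N t s) := by
    filter_upwards [lt_mem_nhds hh] with s hs using partialH_avgFreeEnergy hP ht hs.le
  refine (((H.const_mul (1 / 2)).const_mul (1 / (N : ℝ))).congr_of_eventuallyEq heq).congr_deriv ?_
  simp only [dsum, Finset.mul_sum, mul_assoc]

lemma hasDerivAt_freeEnergy_h (hP : ∃ R : ℝ, ∀ᵐ x ∂P, |x| ≤ R) {t h : ℝ} (ht : 0 ≤ t)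
    (hh : 0 < h) (ω : Disorder N) :
    HasDerivAt (fun s => freeEnergy P N ω t s)
      (1 / N * dlogZ (priorN P N) (rankOneFeatures N) (rankOneStrength N t 0) (vectorWeight N) h
        (disorderEquiv N ω)) h := by
  have H := hasDerivAt_logZ (bddObs_rankOneFeatures hP (N := N))
    (rankOneStrength_nonneg N ht le_rfl) (vectorWeight_nonneg N) hh (disorderEquiv N ω)
  simp only [strength_vectorWeight] at H
  simp only [freeEnergy_eq]
  exact H.const_mul _

end RankOneChannel

end RankOne

theorem proposition2 (P : Measure ℝ) [IsProbabilityMeasure P]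
    (hP : ∃ R : ℝ, ∀ᵐ x ∂P, |x| ≤ R) :
    ∃ C : ℝ, ∀ N : ℕ, 1 ≤ N → ∀ t h : ℝ, 0 ≤ t → 0 ≤ h →
      -- the averaged free energy and its first partial derivatives are well defined
      Integrable (fun ω => freeEnergy P N ω t h) (disorderLaw P N) ∧
      DifferentiableWithinAt ℝ (fun s => avgFreeEnergy P N s h) (Ici 0) t ∧
      DifferentiableWithinAt ℝ (fun s => avgFreeEnergy P N t s) (Ici 0) h ∧
      -- the lower bound
      0 ≤ partialT (avgFreeEnergy P N) t h - 2 * partialH (avgFreeEnergy P N) t h ^ 2 ∧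
      -- the upper bound, whose right side is infinite for `h = 0`
      (0 < h →
        (∀ ω, DifferentiableAt ℝ (fun s => freeEnergy P N ω t s) h) ∧
        DifferentiableAt ℝ (fun s => partialH (avgFreeEnergy P N) t s) h ∧
        Integrable (fun ω => (partialH (freeEnergy P N ω) t h
          - partialH (avgFreeEnergy P N) t h) ^ 2) (disorderLaw P N) ∧
        partialT (avgFreeEnergy P N) t h - 2 * partialH (avgFreeEnergy P N) t h ^ 2
          ≤ 2 / N * partialH (partialH (avgFreeEnergy P N)) t h
            + 2 * ∫ ω, (partialH (freeEnergy P N ω) t h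
                - partialH (avgFreeEnergy P N) t h) ^ 2 ∂(disorderLaw P N)
            + C / N * (1 / h + 1 / √h)) ∧
      -- monotonicity in `h`
      0 ≤ partialH (avgFreeEnergy P N) t h := by
  -- No error term is needed. The singular part `𝔼[z · ⟨x⟩] / h^(3/2)` of `∂_h² F̄_N` is compensated
  -- by the mean Gibbs variance of the noise term `z · x / (2 √h)`.
  refine ⟨0, fun N hN t h ht hh => ?_⟩
  have hφ := bddObs_rankOneFeatures hP (N := N)
  have hN0 : (0 : ℝ) < N := by exact_mod_cast hN
  have hT := partialT_avgFreeEnergy (N := N) hP ht hh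
  have hH := partialH_avgFreeEnergy (N := N) hP ht hh
  refine ⟨?_, (hasDerivWithinAt_avgFreeEnergy_t hP ht hh).differentiableWithinAt,
    (hasDerivWithinAt_avgFreeEnergy_h hP ht hh).differentiableWithinAt, ?_, fun hh0 => ?_, ?_⟩
  · simp only [freeEnergy_eq]
    exact (measurePreserving_disorderEquiv.integrable_comp_of_integrable
      (integrable_logZ hφ _)).const_mul _
  · have h1 : meanOverlap P N t h ^ 2 ≤ meanSqOverlap P N t h :=
      sq_sum_integral_gm_sq_le hφ (vectorWeight_nonneg N)
    have e : 1 / (N : ℝ) * (1 / 2 * ((N : ℝ)⁻¹ * meanSqOverlap P N t h))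
        - 2 * (1 / N * (1 / 2 * meanOverlap P N t h)) ^ 2
        = (meanSqOverlap P N t h - meanOverlap P N t h ^ 2) / (2 * N ^ 2) := by
      field_simp
    rw [hT, hH, e]
    exact div_nonneg (sub_nonneg.2 h1) (by positivity)
  · have hF := fun ω => hasDerivAt_freeEnergy_h (N := N) hP ht hh0 ω
    have hFH : ∀ ω, partialH (freeEnergy P N ω) t h = _ := fun ω =>
      (hF ω).hasDerivWithinAt.derivWithin (uniqueDiffOn_Ici 0 h hh)
    have hD := hasDerivAt_partialH_avgFreeEnergy (N := N) hP ht hh0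
    have hHH : partialH (partialH (avgFreeEnergy P N)) t h = _ :=
      hD.hasDerivWithinAt.derivWithin (uniqueDiffOn_Ici 0 h hh)
    have hσ := rankOneStrength_nonneg N ht (le_refl (0 : ℝ))
    have hm := memLp_dlogZ hφ (rankOneStrength N t 0) (vectorWeight N) h
    have hmean := integral_dlogZ hφ hσ (vectorWeight_nonneg N) hh0
    have hvar := variance_overlap_le hφ hσ (vectorWeight_nonneg N) hh0
    simp only [strength_vectorWeight] at hmean hvar
    set U := dlogZ (priorN P N) (rankOneFeatures N) (rankOneStrength N t 0) (vectorWeight N) h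
    set D := meanOverlap P N t h with hDdef
    have hmean' : ∫ ω, U ω ∂(plantedLaw (priorN P N) (Channel N)) = 1 / 2 * D := hmean
    have hexp : ∀ ω, (1 / (N : ℝ) * U ω - 1 / N * (1 / 2 * D)) ^ 2
        = (1 / (N : ℝ)) ^ 2 * (U ω ^ 2 - D * U ω + D ^ 2 / 4) := fun ω => by ring
    have iU := hm.integrable_sq
    have iU1 := hm.integrable one_le_two
    have iS : Integrable (fun ω => U ω ^ 2 - D * U ω) (plantedLaw (priorN P N) (Channel N)) :=
      iU.sub (iU1.const_mul D)
    refine ⟨fun ω => (hF ω).differentiableAt, hD.differentiableAt, ?_, ?_⟩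
    · simp only [hFH, hH, hexp]
      exact measurePreserving_disorderEquiv.integrable_comp_of_integrable
        (g := fun ω => (1 / (N : ℝ)) ^ 2 * (U ω ^ 2 - D * U ω + D ^ 2 / 4))
        ((iS.add (integrable_const _)).const_mul _)
    · have hint : ∫ ω, (partialH (freeEnergy P N ω) t h - partialH (avgFreeEnergy P N) t h) ^ 2
          ∂(disorderLaw P N) = (1 / (N : ℝ)) ^ 2 *
            (∫ ω, U ω ^ 2 ∂(plantedLaw (priorN P N) (Channel N)) - D ^ 2 / 4) := by
        simp only [hFH, hH, hexp]
        rw [integral_comp_disorderEquiv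
          (fun ω => (1 / (N : ℝ)) ^ 2 * (U ω ^ 2 - D * U ω + D ^ 2 / 4)), integral_const_mul,
          integral_add iS (integrable_const _), integral_sub iU (iU1.const_mul D),
          integral_const_mul, hmean', integral_const, probReal_univ, one_smul]
        ring
      rw [hint, hHH, hT, hH]
      have hvar' := mul_le_mul_of_nonneg_left hvar
        (show 0 ≤ 2 * (1 / (N : ℝ)) ^ 2 by positivity)
      rw [← sub_nonneg] at hvar' ⊢
      refine hvar'.trans (le_of_eq ?_)
      rw [meanSqOverlap]
      field_simp
      ring
  · rw [hH]
    have : 0 ≤ meanOverlap P N t h := Finset.sum_nonneg fun k _ =>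
      mul_nonneg (vectorWeight_nonneg N k) (integral_nonneg fun ω => sq_nonneg _)
    positivity
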